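/- Graphs are finite; loops and multiple edges are allowed. Let $\Gamma$ be a graph with a base vertex $b$ and a linear ordering of its edges. A \emph{reduced enhanced state} $S$ is a spanning subgraph of $\Gamma$ whose connected components are coloured by $x$ and $1$, the component of $b$ being coloured $x$. Its dimension is its number of edges, and its degree is the number of components coloured $x$, minus $1$. Let $\widetilde C^{i,j}(\Gamma)$ be the real vector space with basis the reduced enhanced states of dimension $i$ and degree $j$. The differential $d\colon\widetilde C^{i,j}(\Gamma)\to\widetilde C^{i+1,j}(\Gamma)$ sends $S$ to $\sum_{e\notin S}(-1)^{n(S,e)}\,(S\cup e)$, where $n(S,e)$ is the number of edges of $S$ that precede $e$. In $S\cup e$, components that do not change keep their colour, and if $e$ joins two different components then the new component is coloured by the rule $1\times 1=1$, $1\times x=x\times 1=x$, $x\times x=0$ (in the last case the term is $0$). The \emph{reduced chromatic cohomology} of $\Gamma$ is $$\widetilde H^{i,j}(\Gamma)=\frac{\ker\bigl(d\colon\widetilde C^{i,j}(\Gamma)\to\widetilde C^{i+1,j}(\Gamma)\bigr)}{\operatorname{im}\bigl(d\colon\widetilde C^{i-1,j}(\Gamma)\to\widetilde C^{i,j}(\Gamma)\bigr)}.$$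 Two graphs $\Gamma$ and $\Gamma'$ are \emph{related by a Whitney twist} if there are graphs $\Gamma_1$, $\Gamma_2$ and edges $e_1$ of $\Gamma_1$ and $e_2$ of $\Gamma_2$, which are not loops, such that, up to isomorphism, $\Gamma$ is obtained by gluing $e_1$ to $e_2$ (together with their endpoints) in one of the two possible ways and then removing the resulting single edge, and $\Gamma'$ is obtained in the same manner from the other way of gluing $e_1$ to $e_2$. \textbf{Proposition.} Let $\Gamma$ and $\Gamma'$ be related by a Whitney twist, and let $\Gamma$ be connected. Then, for every choice of base vertices and of edge orderings of $\Gamma$ and $\Gamma'$, $\widetilde H^{i,j}(\Gamma)\cong\widetilde H^{i,j}(\Gamma')$ as real vector spaces for all $i,j$. -/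

import Mathlib

open scoped Graph

universe w

noncomputable section

namespace ReducedChromatic

/-- The connected components of the state (spanning subgraph) of `G` with edge set `F`. -/
abbrev Comp {α β : Type*} (G : Graph α β) (F : Set β) : Type _ :=
  (G.restrict F).toSimpleGraph.ConnectedComponent

/-- The component of the vertex `v` in the state with edge set `F`. -/
def compOf {α β : Type*} (G : Graph α β) (F : Set β) (v : V(G)) : Comp G F :=
  (G.restrict F).toSimpleGraph.connectedComponentMk v

theorem toSimpleGraph_restrict_mono {α β : Type*} (G : Graph α β) {F F' : Set β} (h : F ⊆ F') :
    ∀ u v : V(G), (G.restrict F).toSimpleGraph.Adj u v → (G.restrict F').toSimpleGraph.Adj u v := by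
  rintro u v ⟨hne, e, he⟩
  exact ⟨hne, e, he.mono (Graph.restrict_mono_right G h)⟩

/-- Adding edges to a state merges components: this sends every component of the smaller state
to the component of the larger state that contains it. -/
def compMap {α β : Type*} (G : Graph α β) {F F' : Set β} (h : F ⊆ F') : Comp G F → Comp G F' :=
  SimpleGraph.ConnectedComponent.map
    (⟨fun v => v, fun {u v} huv => toSimpleGraph_restrict_mono G h u v huv⟩ :
      (G.restrict F).toSimpleGraph →g (G.restrict F').toSimpleGraph)

theorem compMap_compOf {α β : Type*} (G : Graph α β) {F F' : Set β} (h : F ⊆ F') (v : V(G)) :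
    compMap G h (compOf G F v) = compOf G F' v := rfl

/-- A reduced enhanced state of the graph `G` with base point `b`: a spanning subgraph, given by
its set of edges, with its connected components coloured by `x` and `1` such that the component
of the base point has colour `x`. The colouring is given by the set of components coloured `x`. -/
@[ext]
structure EnhancedState {α β : Type*} (G : Graph α β) (b : V(G)) where
  edges : Set β
  edges_subset : edges ⊆ E(G)
  colorX : Set (Comp G edges)
  base_mem : compOf G edges b ∈ colorX

namespace EnhancedState

/-- The dimension of a state: its number of edges. -/
def dim {α β : Type*} {G : Graph α β} {b : V(G)} (S : EnhancedState G b) : ℤ :=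
  (S.edges.ncard : ℤ)

/-- The degree of a reduced enhanced state: the number of components coloured `x`, minus one. -/
def deg {α β : Type*} {G : Graph α β} {b : V(G)} (S : EnhancedState G b) : ℤ :=
  (S.colorX.ncard : ℤ) - 1

/-- The state obtained by adding the edge `e`. A component of the new state is coloured `x` if it
contains a component of the old state coloured `x`, and `1` otherwise. This is the rule
`1 × 1 = 1`, `1 × x = x × 1 = x`, and components that do not change keep their colour; the
remaining rule `x × x = 0` is a case distinction in the differential. -/
def addEdge {α β : Type*} {G : Graph α β} {b : V(G)} (S : EnhancedState G b) (e : β)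
    (he : e ∈ E(G)) : EnhancedState G b where
  edges := insert e S.edges
  edges_subset := Set.insert_subset he S.edges_subset
  colorX := compMap G (Set.subset_insert e S.edges) '' S.colorX
  base_mem := ⟨compOf G S.edges b, S.base_mem, rfl⟩

end EnhancedState

/-- The real vector space spanned by all reduced enhanced states of `G`. -/
def CochainSpace {α β : Type*} (G : Graph α β) (b : V(G)) : Type _ := EnhancedState G b →₀ ℝ

instance {α β : Type*} (G : Graph α β) (b : V(G)) : AddCommGroup (CochainSpace G b) :=
  inferInstanceAs (AddCommGroup (EnhancedState G b →₀ ℝ))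

instance {α β : Type*} (G : Graph α β) (b : V(G)) : Module ℝ (CochainSpace G b) :=
  inferInstanceAs (Module ℝ (EnhancedState G b →₀ ℝ))

/-- The reduced enhanced states form a basis of the space that they span. -/
def stateBasis {α β : Type*} (G : Graph α β) (b : V(G)) :
    Module.Basis (EnhancedState G b) ℝ (CochainSpace G b) :=
  Module.Basis.ofRepr (LinearEquiv.refl ℝ (EnhancedState G b →₀ ℝ))

open Classical in
/-- The contribution of the edge `e` to the differential of `S`. It is zero if `e` joins two
different components that are both coloured `x` (that is, if two components coloured `x` become
equal), and otherwise it is the new state with the sign given by the number of edges of `S` that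
precede `e`. -/
def EnhancedState.dEdge {α β : Type*} [LinearOrder β] {G : Graph α β} {b : V(G)} (S : EnhancedState G b) (e : β)
    (he : e ∈ E(G)) : CochainSpace G b :=
  if Set.InjOn (compMap G (Set.subset_insert e S.edges)) S.colorX then
    (-1 : ℝ) ^ {f ∈ S.edges | f < e}.ncard • stateBasis G b (S.addEdge e he)
  else 0

/-- The differential on the space spanned by all reduced enhanced states: a state is sent to
the signed sum over all ways of adding an edge to it. -/
def d {α β : Type*} [LinearOrder β] (G : Graph α β) (b : V(G)) :
    CochainSpace G b →ₗ[ℝ] CochainSpace G b :=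
  (stateBasis G b).constr ℝ fun S : EnhancedState G b =>
    ∑ᶠ e : ↥(E(G) \ S.edges), S.dEdge e.1 e.2.1

/-- The cochain group of bidegree `(i, j)`: the span of the reduced enhanced states of dimension
`i` and degree `j`. -/
def cochain {α β : Type*} (G : Graph α β) (b : V(G)) (i j : ℤ) :
    Submodule ℝ (CochainSpace G b) :=
  Submodule.span ℝ (stateBasis G b '' {S | S.dim = i ∧ S.deg = j})

theorem compMap_comp {α β : Type*} (G : Graph α β) {F F' F'' : Set β} (h : F ⊆ F') (h' : F' ⊆ F'')
    (c : Comp G F) : compMap G h' (compMap G h c) = compMap G (h.trans h') c := by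
  induction c using SimpleGraph.ConnectedComponent.ind with
  | h v => rfl

/-- Adding several edges to a state. -/
def EnhancedState.extend {α β : Type*} {G : Graph α β} {b : V(G)} (S : EnhancedState G b)
    (F : Set β) (h : S.edges ⊆ F) (hF : F ⊆ E(G)) : EnhancedState G b where
  edges := F
  edges_subset := hF
  colorX := compMap G h '' S.colorX
  base_mem := ⟨compOf G S.edges b, S.base_mem, rfl⟩

theorem addEdge_addEdge {α β : Type*} {G : Graph α β} {b : V(G)} (S : EnhancedState G b) (e f : β)
    (he : e ∈ E(G)) (hf : f ∈ E(G)) :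
    (S.addEdge e he).addEdge f hf = S.extend (insert f (insert e S.edges))
      ((Set.subset_insert _ _).trans (Set.subset_insert _ _))
      (Set.insert_subset hf (Set.insert_subset he S.edges_subset)) := by
  have : compMap G (Set.subset_insert f (insert e S.edges)) ''
      (compMap G (Set.subset_insert e S.edges) '' S.colorX) =
      compMap G ((Set.subset_insert e S.edges).trans (Set.subset_insert f _)) '' S.colorX := by
    rw [Set.image_image]
    exact Set.image_congr fun c _ => compMap_comp G _ _ c
  simp only [EnhancedState.addEdge, EnhancedState.extend]
  congr 1

theorem addEdge_comm {α β : Type*} {G : Graph α β} {b : V(G)} (S : EnhancedState G b) (e f : β)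
    (he : e ∈ E(G)) (hf : f ∈ E(G)) :
    (S.addEdge e he).addEdge f hf = (S.addEdge f hf).addEdge e he := by
  rw [addEdge_addEdge, addEdge_addEdge]
  congr 1
  exact Set.insert_comm _ _ _

theorem injOn_iff {α β : Type*} {G : Graph α β} {b : V(G)} (S : EnhancedState G b) (e f : β)
    (he : e ∈ E(G)) :
    (Set.InjOn (compMap G (Set.subset_insert e S.edges)) S.colorX ∧
      Set.InjOn (compMap G (Set.subset_insert f (S.addEdge e he).edges)) (S.addEdge e he).colorX) ↔
    Set.InjOn (compMap G (F' := insert f (insert e S.edges))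
      ((Set.subset_insert _ _).trans (Set.subset_insert _ _))) S.colorX := by
  constructor
  · rintro ⟨h1, h2⟩ x hx y hy hxy
    rw [← compMap_comp G (Set.subset_insert e _) (Set.subset_insert f _), ← compMap_comp G (Set.subset_insert e _) (Set.subset_insert f _)] at hxy
    exact h1 hx hy (h2 ⟨x, hx, rfl⟩ ⟨y, hy, rfl⟩ hxy)
  · intro h
    refine ⟨fun x hx y hy hxy => h hx hy ?_, ?_⟩
    · rw [← compMap_comp G (Set.subset_insert e _) (Set.subset_insert f _), hxy, compMap_comp]
    · rintro _ ⟨x, hx, rfl⟩ _ ⟨y, hy, rfl⟩ hxy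
      have hxy' := ((compMap_comp G (Set.subset_insert e _) (Set.subset_insert f _) x).symm.trans
        hxy).trans (compMap_comp G _ _ y)
      rw [h hx hy hxy']

theorem d_stateBasis {α β : Type*} [LinearOrder β] (G : Graph α β) (b : V(G))
    (S : EnhancedState G b) :
    d G b (stateBasis G b S) = ∑ᶠ e : ↥(E(G) \ S.edges), S.dEdge e.1 e.2.1 := by
  simp [d, Module.Basis.constr_basis]

theorem sign_aux {β : Type*} [LinearOrder β] (F : Set β) (hF : F.Finite) (e f : β) (he : e ∉ F)
    (hef : e < f) :
    (-1 : ℝ) ^ {g ∈ F | g < e}.ncard * (-1 : ℝ) ^ {g ∈ insert e F | g < f}.ncard =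
    -((-1 : ℝ) ^ {g ∈ F | g < f}.ncard * (-1 : ℝ) ^ {g ∈ insert f F | g < e}.ncard) := by
  have h1 : {g ∈ insert e F | g < f} = insert e {g ∈ F | g < f} := by
    ext g; grind
  have h2 : {g ∈ insert f F | g < e} = {g ∈ F | g < e} := by
    ext g; grind
  rw [h1, h2, Set.ncard_insert_of_notMem (by grind) (hF.subset (Set.sep_subset _ _))]
  ring

open Classical in
/-- The differential of a finite graph squares to zero. -/
theorem d_comp_d {α β : Type*} [LinearOrder β] (G : Graph α β) (b : V(G)) (hE : E(G).Finite) :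
    d G b ∘ₗ d G b = 0 := by
  let t (S : EnhancedState G b) (e : β) : CochainSpace G b :=
    if h : e ∈ E(G) ∧ e ∉ S.edges then S.dEdge e h.1 else 0
  have key (S : EnhancedState G b) : d G b (stateBasis G b S) = ∑ e ∈ hE.toFinset, t S e := by
    rw [d_stateBasis]
    have : ∀ e : ↥(E(G) \ S.edges), S.dEdge e.1 e.2.1 = t S e.1 := fun e => by
      have : e.1 ∈ E(G) ∧ e.1 ∉ S.edges := e.2
      simp [t, this]
    rw [finsum_congr this, finsum_set_coe_eq_finsum_mem (E(G) \ S.edges) (f := t S),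
      finsum_mem_eq_finite_toFinset_sum _ (hE.subset Set.sdiff_subset)]
    apply Finset.sum_subset
    · intro e; simp; tauto
    · intro e he he'
      have : ¬ (e ∈ E(G) ∧ e ∉ S.edges) := by simpa using he'
      simp only [t, dif_neg this]
  apply (stateBasis G b).ext
  intro S
  let q (e f : β) : CochainSpace G b :=
    if h : (e ∈ E(G) ∧ e ∉ S.edges) ∧ (f ∈ E(G) ∧ f ∉ S.edges) ∧ e ≠ f ∧ Set.InjOn (compMap G (F' := insert f (insert e S.edges))
      ((Set.subset_insert _ _).trans (Set.subset_insert _ _))) S.colorX then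
     ((-1 : ℝ) ^ {g ∈ S.edges | g < e}.ncard * (-1 : ℝ) ^ {g ∈ insert e S.edges | g < f}.ncard) • stateBasis G b ((S.addEdge e h.1.1).addEdge f h.2.1.1) else 0
  have hq (e f) : q e f = - q f e := by
    have inj : Set.InjOn (compMap G (F' := insert f (insert e S.edges))
      ((Set.subset_insert _ _).trans (Set.subset_insert _ _))) S.colorX ↔ Set.InjOn (compMap G (F' := insert e (insert f S.edges))
      ((Set.subset_insert _ _).trans (Set.subset_insert _ _))) S.colorX := by
      have : ∀ (F F' : Set β) (h : S.edges ⊆ F) (h' : S.edges ⊆ F'), F = F' → (Set.InjOn (compMap G h) S.colorX ↔ Set.InjOn (compMap G h') S.colorX) := by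
        rintro F _ h h' rfl; rfl
      exact this _ _ _ _ (Set.insert_comm _ _ _)
    by_cases h : (e ∈ E(G) ∧ e ∉ S.edges) ∧ (f ∈ E(G) ∧ f ∉ S.edges) ∧ e ≠ f ∧ Set.InjOn (compMap G (F' := insert f (insert e S.edges))
      ((Set.subset_insert _ _).trans (Set.subset_insert _ _))) S.colorX
    · have h' : (f ∈ E(G) ∧ f ∉ S.edges) ∧ (e ∈ E(G) ∧ e ∉ S.edges) ∧ f ≠ e ∧ Set.InjOn (compMap G (F' := insert e (insert f S.edges))
        ((Set.subset_insert _ _).trans (Set.subset_insert _ _))) S.colorX := ⟨h.2.1, h.1, h.2.2.1.symm, inj.1 h.2.2.2⟩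
      simp only [q]
      rw [dif_pos h, dif_pos h', addEdge_comm S e f h.1.1 h.2.1.1, ← neg_smul]
      congr 1
      have hfin := hE.subset S.edges_subset
      rcases lt_or_gt_of_ne h.2.2.1 with hlt | hlt
      · exact sign_aux _ hfin _ _ h.1.2 hlt
      · rw [sign_aux _ hfin _ _ h.2.1.2 hlt, neg_neg]
    · have h' : ¬ ((f ∈ E(G) ∧ f ∉ S.edges) ∧ (e ∈ E(G) ∧ e ∉ S.edges) ∧ f ≠ e ∧ Set.InjOn (compMap G (F' := insert e (insert f S.edges))
        ((Set.subset_insert _ _).trans (Set.subset_insert _ _))) S.colorX) := fun h' => h ⟨h'.2.1, h'.1, h'.2.2.1.symm, inj.2 h'.2.2.2⟩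
      simp only [q]
      rw [dif_neg h, dif_neg h', neg_zero]
  have hd (e) : d G b (t S e) = ∑ f ∈ hE.toFinset, q e f := by
    by_cases h : e ∈ E(G) ∧ e ∉ S.edges
    · simp only [t, dif_pos h, EnhancedState.dEdge]
      split_ifs with hi
      · rw [map_smul, key, Finset.smul_sum]
        refine Finset.sum_congr rfl fun f _ => ?_
        have ed : (S.addEdge e h.1).edges = insert e S.edges := rfl
        by_cases hf : f ∈ E(G) ∧ f ∉ (S.addEdge e h.1).edges
        · simp only [t, dif_pos hf, EnhancedState.dEdge]
          split_ifs with hi'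
          · have : (e ∈ E(G) ∧ e ∉ S.edges) ∧ (f ∈ E(G) ∧ f ∉ S.edges) ∧ e ≠ f ∧ Set.InjOn (compMap G (F' := insert f (insert e S.edges)) ((Set.subset_insert _ _).trans (Set.subset_insert _ _))) S.colorX :=
              ⟨h, ⟨hf.1, fun hh => hf.2 (Or.inr hh)⟩, fun hh => hf.2 (Or.inl hh.symm), (injOn_iff S e f h.1).1 ⟨hi, hi'⟩⟩
            simp only [q, dif_pos this]
            rw [smul_smul]; rfl
          · simp only [q]
            rw [dif_neg, smul_zero]
            rintro ⟨-, -, -, h4⟩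
            exact hi' ((injOn_iff S e f h.1).2 h4).2
        · simp only [t, dif_neg hf, q]
          rw [dif_neg, smul_zero]
          rintro ⟨-, h2, h3, -⟩
          exact hf ⟨h2.1, fun hh => hh.elim (fun h => h3 h.symm) h2.2⟩
      · rw [map_zero, Finset.sum_eq_zero]
        intro f _
        simp only [q]
        rw [dif_neg]
        rintro ⟨-, -, -, h4⟩
        exact hi ((injOn_iff S e f h.1).2 h4).1
    · simp only [t, dif_neg h, map_zero]
      rw [Finset.sum_eq_zero]
      intro f _
      simp only [q]
      rw [dif_neg]
      exact fun h' => h h'.1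
  rw [LinearMap.comp_apply, key, map_sum, LinearMap.zero_apply]
  simp only [hd]
  have : ∑ e ∈ hE.toFinset, ∑ f ∈ hE.toFinset, q e f = - ∑ e ∈ hE.toFinset, ∑ f ∈ hE.toFinset, q e f := by
    conv_lhs => rw [Finset.sum_comm]
    simp only [← Finset.sum_neg_distrib]
    refine Finset.sum_congr rfl fun e _ => Finset.sum_congr rfl fun f _ => hq _ _
  have h2 := add_eq_zero_iff_eq_neg.2 this
  rw [← two_smul ℝ] at h2
  exact (smul_eq_zero.1 h2).resolve_left two_ne_zero

/-- The differential has bidegree `(1, 0)`. -/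
theorem map_d_le {α β : Type*} [LinearOrder β] (G : Graph α β) (b : V(G)) (hE : E(G).Finite)
    (i j : ℤ) : (cochain G b i j).map (d G b) ≤ cochain G b (i + 1) j := by
  rw [cochain, Submodule.map_span, Submodule.span_le]
  rintro _ ⟨_, ⟨S, ⟨hi, hj⟩, rfl⟩, rfl⟩
  rw [d_stateBasis]
  refine finsum_induction (p := (· ∈ cochain G b (i+1) j)) (Submodule.zero_mem _) (fun _ _ => Submodule.add_mem _) ?_
  intro e
  unfold EnhancedState.dEdge
  split_ifs with h
  · refine Submodule.smul_mem _ _ (Submodule.subset_span ⟨_, ⟨?_, ?_⟩, rfl⟩)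
    · simp only [EnhancedState.dim, EnhancedState.addEdge] at hi ⊢
      rw [Set.ncard_insert_of_notMem e.2.2 (hE.subset S.edges_subset)]; push_cast; omega
    · simp only [EnhancedState.deg, EnhancedState.addEdge] at hj ⊢
      rw [h.ncard_image, hj]
  · exact Submodule.zero_mem _

/-- The cocycles of bidegree `(i, j)`. -/
def cocycles {α β : Type*} [LinearOrder β] (G : Graph α β) (b : V(G)) (i j : ℤ) :
    Submodule ℝ (CochainSpace G b) :=
  cochain G b i j ⊓ LinearMap.ker (d G b)

/-- The coboundaries of bidegree `(i, j)`: the image of the cochain group of bidegree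
`(i - 1, j)`. -/
def coboundaries {α β : Type*} [LinearOrder β] (G : Graph α β) (b : V(G)) (i j : ℤ) :
    Submodule ℝ (CochainSpace G b) :=
  (cochain G b (i - 1) j).map (d G b)

/-- The reduced chromatic cohomology group of bidegree `(i, j)` of the graph `G` with base point
`b`, with respect to the given ordering of the edges: cocycles modulo coboundaries. -/
abbrev Cohomology {α β : Type*} [LinearOrder β] (G : Graph α β) (b : V(G)) (i j : ℤ) : Type _ :=
  ↥(cocycles G b i j) ⧸ (coboundaries G b i j).submoduleOf (cocycles G b i j)

/-- An isomorphism of (multi)graphs. -/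
structure GraphIso {α β α' β' : Type*} (G : Graph α β) (G' : Graph α' β') where
  vertexEquiv : V(G) ≃ V(G')
  edgeEquiv : E(G) ≃ E(G')
  isLink_iff : ∀ (e : E(G)) (x y : V(G)),
    G'.IsLink (edgeEquiv e).1 (vertexEquiv x).1 (vertexEquiv y).1 ↔ G.IsLink e.1 x.1 y.1

/-- The disjoint union of two graphs. -/
def disjointUnion {α₁ β₁ α₂ β₂ : Type*} (G₁ : Graph α₁ β₁) (G₂ : Graph α₂ β₂) :
    Graph (α₁ ⊕ α₂) (β₁ ⊕ β₂) where
  vertexSet := Sum.inl '' V(G₁) ∪ Sum.inr '' V(G₂)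
  IsLink e x y :=
    (∃ f a c, G₁.IsLink f a c ∧ e = Sum.inl f ∧ x = Sum.inl a ∧ y = Sum.inl c) ∨
    (∃ f a c, G₂.IsLink f a c ∧ e = Sum.inr f ∧ x = Sum.inr a ∧ y = Sum.inr c)
  isLink_symm := by
    refine fun e _ => ⟨?_⟩
    rintro x y (⟨f, a, c, h, rfl, rfl, rfl⟩ | ⟨f, a, c, h, rfl, rfl, rfl⟩)
    · exact Or.inl ⟨f, c, a, h.symm, rfl, rfl, rfl⟩
    · exact Or.inr ⟨f, c, a, h.symm, rfl, rfl, rfl⟩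
  eq_or_eq_of_isLink_of_isLink := by
    rintro e x y v w (⟨f, a, c, h, rfl, rfl, rfl⟩ | ⟨f, a, c, h, rfl, rfl, rfl⟩)
      (⟨f', a', c', h', hf, rfl, rfl⟩ | ⟨f', a', c', h', hf, rfl, rfl⟩)
    · obtain rfl := Sum.inl.inj hf
      rcases h.left_eq_or_eq h' with rfl | rfl <;> simp
    · cases hf
    · cases hf
    · obtain rfl := Sum.inr.inj hf
      rcases h.left_eq_or_eq h' with rfl | rfl <;> simp
  left_mem_of_isLink := by
    rintro e x y (⟨f, a, c, h, rfl, rfl, rfl⟩ | ⟨f, a, c, h, rfl, rfl, rfl⟩)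
    · exact Or.inl ⟨a, h.left_mem, rfl⟩
    · exact Or.inr ⟨a, h.left_mem, rfl⟩

/-- The identification of the vertex `u₁` with `u₂` and of `v₁` with `v₂`. -/
inductive GlueRel {α₁ α₂ : Type*} (u₁ v₁ : α₁) (u₂ v₂ : α₂) : α₁ ⊕ α₂ → α₁ ⊕ α₂ → Prop
  | fst : GlueRel u₁ v₁ u₂ v₂ (Sum.inl u₁) (Sum.inr u₂)
  | snd : GlueRel u₁ v₁ u₂ v₂ (Sum.inl v₁) (Sum.inr v₂)

/-- The graph obtained from `G₁` and `G₂` by gluing an edge of `G₁` with ends `u₁`, `v₁` to the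
edge `e₂` of `G₂` with ends `u₂`, `v₂`, so that `u₁` is glued to `u₂` and `v₁` to `v₂`. The edge
that results is represented by the edge of `G₁`. -/
def edgeGluing {α₁ β₁ α₂ β₂ : Type*} (G₁ : Graph α₁ β₁) (G₂ : Graph α₂ β₂) (e₂ : β₂)
    (u₁ v₁ : α₁) (u₂ v₂ : α₂) : Graph (Quot (GlueRel u₁ v₁ u₂ v₂)) (β₁ ⊕ β₂) :=
  ((disjointUnion G₁ G₂).deleteEdges {Sum.inr e₂}).map (Quot.mk (GlueRel u₁ v₁ u₂ v₂))

/-- `Γ` and `Γ'` are related by a Whitney twist: there are graphs `G₁`, `G₂` with (non-loop) edges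
`e₁`, `e₂` such that `Γ` and `Γ'` are obtained from the two ways of gluing `e₁` to `e₂` by removing
the edge that results. -/
def IsWhitneyTwist {α β α' β' : Type*} (Γ : Graph α β) (Γ' : Graph α' β') : Prop :=
  ∃ (α₁ β₁ α₂ β₂ : Type w) (G₁ : Graph α₁ β₁) (G₂ : Graph α₂ β₂)
    (e₁ : β₁) (u₁ v₁ : α₁) (e₂ : β₂) (u₂ v₂ : α₂),
    G₁.IsLink e₁ u₁ v₁ ∧ u₁ ≠ v₁ ∧ G₂.IsLink e₂ u₂ v₂ ∧ u₂ ≠ v₂ ∧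
    Nonempty (GraphIso Γ ((edgeGluing G₁ G₂ e₂ u₁ v₁ u₂ v₂).deleteEdges {Sum.inl e₁})) ∧
    Nonempty (GraphIso Γ' ((edgeGluing G₁ G₂ e₂ u₁ v₁ v₂ u₂).deleteEdges {Sum.inl e₁}))

end ReducedChromatic

end

/-! The cohomology of a connected graph with `n` vertices is concentrated on the diagonal `i + j = n
- 1` (`cocycles_le_coboundaries`). For each `j` at most one degree therefore carries cohomology, and
its dimension is, up to sign, the Euler characteristic of the complex of degree `j`. So the numbers
of states of each bidegree determine all the cohomology groups (`nonempty_cohomology_equiv`). A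
Whitney twist preserves these numbers: edges correspond to edges, and a spanning subgraph and its
twist have equally many components (`IsWhitneyTwist.exists_edges_equiv`). No chain map between the
two complexes is constructed; the isomorphism comes from equality of dimensions.

The vanishing is proved for a more general family of complexes, which is closed under the induction:
the edge sets range between `A` and `A ∪ D`, and the vertices of a transversal `B` of the components
of `A ∪ D` have their components coloured `x` (`exists_dOn_eq`). One edge of `D` is removed at a
time. If all edges of `D` join vertices in the same component of `A`, adding any one of them is
invertible and the complex is acyclic. Otherwise some edge `e` leaves the component of a vertex of
`B`. If `e` is not a bridge of `A ∪ D`, deletion and contraction of `e` give two smaller complexes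
with the same exceptional diagonal. If `e` is a bridge, cancelling along `e` leaves the states
without `e` whose far end is coloured `x`, so that end joins `B` (`exists_cohomologous`). -/

namespace ReducedChromatic

/-! ### Components of a spanning subgraph when one edge is added -/

section Components

variable {α β : Type*} {G : Graph α β}

theorem compOf_surjective (F : Set β) : Function.Surjective (compOf G F) := by
  intro c
  induction c using SimpleGraph.ConnectedComponent.ind with
  | h v => exact ⟨v, rfl⟩

theorem compOf_eq_of_isLink {F : Set β} {e : β} {u v : V(G)} (he : e ∈ F)
    (h : G.IsLink e u.1 v.1) : compOf G F u = compOf G F v := by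
  by_cases huv : u = v
  · rw [huv]
  · apply SimpleGraph.ConnectedComponent.sound
    apply SimpleGraph.Adj.reachable
    refine ⟨huv, e, ?_⟩
    simp [Graph.restrict, h, he]

/-- A function on the vertices that takes equal values at the ends of each edge of a state is
constant on the components of the state. -/
theorem eq_of_compOf_eq {F : Set β} {γ : Sort*} {f : V(G) → γ}
    (hf : ∀ e ∈ F, ∀ x y : V(G), G.IsLink e x.1 y.1 → f x = f y) {x y : V(G)}
    (h : compOf G F x = compOf G F y) : f x = f y := by
  have hr : (G.restrict F).toSimpleGraph.Reachable x y := SimpleGraph.ConnectedComponent.exact h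
  obtain ⟨p⟩ := hr
  clear h
  induction p with
  | nil => rfl
  | cons hadj p ih =>
    refine Eq.trans ?_ ih
    obtain ⟨-, e, he⟩ := hadj
    have he' := he
    simp only [Graph.restrict_isLink] at he'
    exact hf e (by tauto) _ _ (by tauto)

theorem compOf_eq_mono {F F' : Set β} (h : F ⊆ F') {x y : V(G)}
    (hxy : compOf G F x = compOf G F y) : compOf G F' x = compOf G F' y :=
  congrArg (compMap G h) hxy

theorem compMap_surjective {F F' : Set β} (h : F ⊆ F') : Function.Surjective (compMap G h) := by
  intro c
  obtain ⟨v, rfl⟩ := compOf_surjective F' c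
  exact ⟨compOf G F v, rfl⟩

open Classical in
theorem compOf_insert_eq {F : Set β} {e : β} {u v x y : V(G)} (he : G.IsLink e u.1 v.1)
    (h : compOf G (insert e F) x = compOf G (insert e F) y) :
    compOf G F x = compOf G F y ∨ (compOf G F x = compOf G F u ∧ compOf G F y = compOf G F v) ∨
      (compOf G F x = compOf G F v ∧ compOf G F y = compOf G F u) := by
  -- Relabelling the component of `v` as that of `u` gives a function that is constant along `e` and
  -- along `F`, hence on the components of `insert e F`.
  let f : V(G) → Comp G F := fun w =>
    if compOf G F w = compOf G F v then compOf G F u else compOf G F w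
  have hf : f x = f y := by
    refine eq_of_compOf_eq ?_ h
    rintro g (rfl | hg) a c hac
    · have : (a = u ∧ c = v) ∨ (a = v ∧ c = u) := by
        rcases (hac.eq_and_eq_or_eq_and_eq he) with h | h
        · exact Or.inl ⟨Subtype.ext h.1, Subtype.ext h.2⟩
        · exact Or.inr ⟨Subtype.ext h.1, Subtype.ext h.2⟩
      rcases this with ⟨rfl, rfl⟩ | ⟨rfl, rfl⟩ <;> simp [f]
    · have := compOf_eq_of_isLink (F := F) hg hac
      simp only [f, this]
  by_cases hx : compOf G F x = compOf G F v <;> by_cases hy : compOf G F y = compOf G F v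
  · exact Or.inl (hx.trans hy.symm)
  · simp only [f, hx, hy, if_true, if_false] at hf
    exact Or.inr (Or.inr ⟨hx, hf.symm⟩)
  · simp only [f, hx, hy, if_true, if_false] at hf
    exact Or.inr (Or.inl ⟨hf, hy⟩)
  · simp only [f, hx, hy, if_false] at hf
    exact Or.inl hf

theorem compOf_insert_eq_of_eq {F : Set β} {e : β} {u v x y : V(G)} (he : G.IsLink e u.1 v.1)
    (huv : compOf G F u = compOf G F v)
    (h : compOf G (insert e F) x = compOf G (insert e F) y) : compOf G F x = compOf G F y := by
  rcases compOf_insert_eq he h with h | h | h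
  · exact h
  · rw [h.1, h.2, huv]
  · rw [h.1, h.2, huv]

theorem bijOn_compMap_of_eq {F : Set β} {e : β} {u v : V(G)} (he : G.IsLink e u.1 v.1)
    (huv : compOf G F u = compOf G F v) :
    Set.BijOn (compMap G (Set.subset_insert e F)) Set.univ Set.univ := by
  rw [Set.bijOn_univ]
  refine ⟨?_, compMap_surjective _⟩
  intro c c' h
  obtain ⟨x, rfl⟩ := compOf_surjective F c
  obtain ⟨y, rfl⟩ := compOf_surjective F c'
  exact compOf_insert_eq_of_eq he huv h

/-- The only identification is that of the components of `u` and `v`, so discarding one of the two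
leaves exactly one representative of each new component. -/
theorem bijOn_compMap_of_ne {F : Set β} {e : β} {u v : V(G)} (he : G.IsLink e u.1 v.1)
    (huv : compOf G F u ≠ compOf G F v) :
    Set.BijOn (compMap G (Set.subset_insert e F)) {c | c ≠ compOf G F v} Set.univ := by
  refine ⟨Set.mapsTo_univ _ _, ?_, ?_⟩
  · intro c hc c' hc' h
    obtain ⟨x, rfl⟩ := compOf_surjective F c
    obtain ⟨y, rfl⟩ := compOf_surjective F c'
    rcases compOf_insert_eq he h with h | h | h
    · exact h
    · exact absurd h.2 hc'
    · exact absurd h.1 hc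
  · intro c _
    obtain ⟨x, rfl⟩ := compOf_surjective _ c
    by_cases hx : compOf G F x = compOf G F v
    · refine ⟨compOf G F u, huv, ?_⟩
      rw [compMap_compOf, compOf_eq_of_isLink (Set.mem_insert e F) he]
      exact (compOf_eq_mono (Set.subset_insert e F) hx).symm
    · exact ⟨compOf G F x, hx, rfl⟩

theorem finite_comp [Finite V(G)] (F : Set β) : Finite (Comp G F) :=
  Finite.of_surjective _ (compOf_surjective F)

/-- This keeps the sum of the numbers of edges and components, which locates the exceptional
diagonal, unchanged when an edge is contracted. -/
theorem card_comp_insert [Finite V(G)] {F : Set β} {e : β} {u v : V(G)}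
    (he : G.IsLink e u.1 v.1) (huv : compOf G F u ≠ compOf G F v) :
    Nat.card (Comp G (insert e F)) + 1 = Nat.card (Comp G F) := by
  have := finite_comp (G := G) F
  have h := (bijOn_compMap_of_ne he huv)
  have h1 := h.injOn.ncard_image
  rw [h.image_eq, Set.ncard_univ] at h1
  rw [h1, ← Set.compl_singleton_eq, ← Set.ncard_add_ncard_compl {compOf G F v},
    Set.ncard_singleton, add_comm]

theorem compOf_empty_injective : Function.Injective (compOf G ∅) := fun _ _ h =>
  eq_of_compOf_eq (f := id) (by simp) h

end Components

/-! ### The differential as a sum of anticommuting edge maps -/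

section EdgeMaps

variable {α β : Type*} {G : Graph α β} {b : V(G)}

/-- The span of the states with the property `P`. -/
noncomputable def stateSpan (G : Graph α β) (b : V(G)) (P : Set (EnhancedState G b)) :
    Submodule ℝ (CochainSpace G b) :=
  Submodule.span ℝ (stateBasis G b '' P)

theorem stateSpan_mono {P Q : Set (EnhancedState G b)} (h : P ⊆ Q) :
    stateSpan G b P ≤ stateSpan G b Q :=
  Submodule.span_mono (Set.image_mono h)

theorem mem_stateSpan {P : Set (EnhancedState G b)} {S : EnhancedState G b} (h : S ∈ P) :
    stateBasis G b S ∈ stateSpan G b P :=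
  Submodule.subset_span ⟨S, h, rfl⟩

theorem stateSpan_union (P Q : Set (EnhancedState G b)) :
    stateSpan G b (P ∪ Q) = stateSpan G b P ⊔ stateSpan G b Q := by
  rw [stateSpan, Set.image_union, Submodule.span_union]; rfl

theorem stateSpan_empty : stateSpan G b ∅ = ⊥ := by
  simp [stateSpan]

theorem eq_zero_of_mem_stateSpan_of_mem_stateSpan {P Q : Set (EnhancedState G b)}
    (h : Disjoint P Q) {z : CochainSpace G b} (hP : z ∈ stateSpan G b P)
    (hQ : z ∈ stateSpan G b Q) : z = 0 :=
  (Submodule.disjoint_def.1 ((stateBasis G b).linearIndependent.disjoint_span_image h)) z hP hQ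

theorem exists_add_of_mem_stateSpan {P Q R : Set (EnhancedState G b)} (h : P ⊆ Q ∪ R)
    {z : CochainSpace G b} (hz : z ∈ stateSpan G b P) :
    ∃ x ∈ stateSpan G b Q, ∃ y ∈ stateSpan G b R, x + y = z := by
  have := stateSpan_mono h hz
  rwa [stateSpan_union, Submodule.mem_sup] at this

theorem map_mem_of_mem_stateSpan {M : Type*} [AddCommGroup M] [Module ℝ M]
    {P : Set (EnhancedState G b)} {N : Submodule ℝ M} (f : CochainSpace G b →ₗ[ℝ] M)
    (h : ∀ S ∈ P, f (stateBasis G b S) ∈ N) {z : CochainSpace G b} (hz : z ∈ stateSpan G b P) :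
    f z ∈ N := by
  have : stateSpan G b P ≤ N.comap f := by
    rw [stateSpan, Submodule.span_le]
    rintro _ ⟨S, hS, rfl⟩
    exact h S hS
  exact this hz

variable [LinearOrder β]

open Classical in
/-- The part of the differential that adds the edge `e`. -/
noncomputable def edgeMap (G : Graph α β) (b : V(G)) (e : β) :
    CochainSpace G b →ₗ[ℝ] CochainSpace G b :=
  (stateBasis G b).constr ℝ fun S : EnhancedState G b =>
    if h : e ∈ E(G) ∧ e ∉ S.edges then S.dEdge e h.1 else 0

open Classical in
theorem edgeMap_stateBasis (e : β) (S : EnhancedState G b) :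
    edgeMap G b e (stateBasis G b S) =
      if h : e ∈ E(G) ∧ e ∉ S.edges then S.dEdge e h.1 else 0 := by
  simp [edgeMap, Module.Basis.constr_basis]

theorem edgeMap_of_injOn {e : β} {S : EnhancedState G b} (he : e ∈ E(G)) (heS : e ∉ S.edges)
    (h : Set.InjOn (compMap G (Set.subset_insert e S.edges)) S.colorX) :
    edgeMap G b e (stateBasis G b S) =
      (-1 : ℝ) ^ {f ∈ S.edges | f < e}.ncard • stateBasis G b (S.addEdge e he) := by
  rw [edgeMap_stateBasis, dif_pos ⟨he, heS⟩, EnhancedState.dEdge, if_pos h]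

theorem edgeMap_of_not_injOn {e : β} {S : EnhancedState G b}
    (h : ¬ Set.InjOn (compMap G (Set.subset_insert e S.edges)) S.colorX) :
    edgeMap G b e (stateBasis G b S) = 0 := by
  rw [edgeMap_stateBasis]
  split_ifs with h'
  · rw [EnhancedState.dEdge, if_neg h]
  · rfl

theorem edgeMap_of_mem {e : β} {S : EnhancedState G b} (heS : e ∈ S.edges) :
    edgeMap G b e (stateBasis G b S) = 0 := by
  rw [edgeMap_stateBasis, dif_neg (fun h => h.2 heS)]

theorem edgeMap_of_not_mem_edgeSet {e : β} (he : e ∉ E(G)) (S : EnhancedState G b) :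
    edgeMap G b e (stateBasis G b S) = 0 := by
  rw [edgeMap_stateBasis, dif_neg (fun h => he h.1)]

theorem edgeMap_mem_stateSpan {P Q : Set (EnhancedState G b)} {e : β}
    (h : ∀ S ∈ P, ∀ he : e ∈ E(G), e ∉ S.edges →
      Set.InjOn (compMap G (Set.subset_insert e S.edges)) S.colorX → S.addEdge e he ∈ Q)
    {z : CochainSpace G b} (hz : z ∈ stateSpan G b P) :
    edgeMap G b e z ∈ stateSpan G b Q := by
  refine map_mem_of_mem_stateSpan _ (fun S hS => ?_) hz
  by_cases h1 : e ∈ E(G)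
  · by_cases h2 : e ∈ S.edges
    · rw [edgeMap_of_mem h2]; exact Submodule.zero_mem _
    · by_cases h3 : Set.InjOn (compMap G (Set.subset_insert e S.edges)) S.colorX
      · rw [edgeMap_of_injOn h1 h2 h3]
        exact Submodule.smul_mem _ _ (mem_stateSpan (h S hS h1 h2 h3))
      · rw [edgeMap_of_not_injOn h3]; exact Submodule.zero_mem _
  · rw [edgeMap_of_not_mem_edgeSet h1]; exact Submodule.zero_mem _

theorem edgeMap_eq_zero {P : Set (EnhancedState G b)} {e : β}
    (h : ∀ S ∈ P, e ∈ S.edges ∨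
      ¬ Set.InjOn (compMap G (Set.subset_insert e S.edges)) S.colorX)
    {z : CochainSpace G b} (hz : z ∈ stateSpan G b P) : edgeMap G b e z = 0 := by
  have : edgeMap G b e z ∈ (⊥ : Submodule ℝ (CochainSpace G b)) := by
    refine map_mem_of_mem_stateSpan _ (fun S hS => ?_) hz
    rw [Submodule.mem_bot]
    rcases h S hS with h | h
    · exact edgeMap_of_mem h
    · exact edgeMap_of_not_injOn h
  simpa using this

/-- The differential restricted to adding edges in `D`. -/
noncomputable def dOn (G : Graph α β) (b : V(G)) (D : Finset β) :
    CochainSpace G b →ₗ[ℝ] CochainSpace G b :=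
  ∑ e ∈ D, edgeMap G b e

theorem dOn_eq_add {D : Finset β} {e : β} (he : e ∈ D) (z : CochainSpace G b) :
    dOn G b D z = edgeMap G b e z + dOn G b (D.erase e) z := by
  rw [dOn, ← Finset.add_sum_erase D _ he]; rfl

open Classical in
theorem d_eq_dOn (hE : E(G).Finite) : d G b = dOn G b hE.toFinset := by
  apply (stateBasis G b).ext
  intro S
  rw [d_stateBasis, dOn, LinearMap.sum_apply]
  have : ∀ e : ↥(E(G) \ S.edges),
      S.dEdge e.1 e.2.1 = edgeMap G b e.1 (stateBasis G b S) := fun e => by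
    have h : e.1 ∈ E(G) ∧ e.1 ∉ S.edges := e.2
    rw [edgeMap_stateBasis, dif_pos h]
  rw [finsum_congr this, finsum_set_coe_eq_finsum_mem (E(G) \ S.edges)
      (f := fun e => edgeMap G b e (stateBasis G b S)),
    finsum_mem_eq_finite_toFinset_sum _ (hE.subset Set.sdiff_subset)]
  apply Finset.sum_subset
  · intro e; simp; tauto
  · intro e he he'
    have he : e ∈ E(G) := by simpa using he
    have : ¬ (e ∈ E(G) ∧ e ∉ S.edges) := by simpa using he'
    exact edgeMap_of_mem (by tauto)

/-- A refinement of `d_comp_d` to single pairs of edges; the induction needs it because its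
differentials add only the edges of a subset. -/
theorem edgeMap_edgeMap_of_lt (hE : E(G).Finite) {e f : β} (hef : e < f) (z : CochainSpace G b) :
    edgeMap G b e (edgeMap G b f z) = - edgeMap G b f (edgeMap G b e z) := by
  have key : edgeMap G b e ∘ₗ edgeMap G b f = - (edgeMap G b f ∘ₗ edgeMap G b e) := by
    apply (stateBasis G b).ext
    intro S
    rw [LinearMap.neg_apply, LinearMap.comp_apply, LinearMap.comp_apply]
    by_cases he : e ∈ E(G)
    swap
    · have h0 : edgeMap G b e = 0 := (stateBasis G b).ext fun S =>
        edgeMap_of_not_mem_edgeSet he S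
      simp [h0]
    by_cases hf : f ∈ E(G)
    swap
    · have h0 : edgeMap G b f = 0 := (stateBasis G b).ext fun S =>
        edgeMap_of_not_mem_edgeSet hf S
      simp [h0]
    have zero (e f : β) (hS : e ∈ S.edges) :
        edgeMap G b e (edgeMap G b f (stateBasis G b S)) = 0 := by
      refine edgeMap_eq_zero (P := {S | e ∈ S.edges}) (fun S hS => Or.inl hS) ?_
      refine edgeMap_mem_stateSpan (P := {S | e ∈ S.edges}) ?_ (mem_stateSpan hS)
      exact fun S hS he _ _ => Set.mem_insert_of_mem _ hS
    by_cases heS : e ∈ S.edges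
    · rw [zero e f heS, edgeMap_of_mem heS]; simp
    by_cases hfS : f ∈ S.edges
    · rw [zero f e hfS, edgeMap_of_mem hfS]; simp
    have expand (e f : β) (he : e ∈ E(G)) (hf : f ∈ E(G)) (heS : e ∉ S.edges)
        (hfS : f ∉ S.edges) (hne : e ≠ f) (hi : Set.InjOn (compMap G
          (F' := insert f (insert e S.edges))
          ((Set.subset_insert _ _).trans (Set.subset_insert _ _))) S.colorX) :
        edgeMap G b f (edgeMap G b e (stateBasis G b S)) =
        ((-1 : ℝ) ^ {g ∈ S.edges | g < e}.ncard *
          (-1 : ℝ) ^ {g ∈ insert e S.edges | g < f}.ncard) •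
          stateBasis G b ((S.addEdge e he).addEdge f hf) := by
      obtain ⟨h1, h2⟩ := (injOn_iff S e f he).2 hi
      rw [edgeMap_of_injOn he heS h1, map_smul, edgeMap_of_injOn hf _ h2, smul_smul]
      · rfl
      · rintro (h | h)
        · exact hne h.symm
        · exact hfS h
    have vanish (e f : β) (he : e ∈ E(G)) (heS : e ∉ S.edges) (hi : ¬ Set.InjOn (compMap G
          (F' := insert f (insert e S.edges))
          ((Set.subset_insert _ _).trans (Set.subset_insert _ _))) S.colorX) :
        edgeMap G b f (edgeMap G b e (stateBasis G b S)) = 0 := by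
      rw [← injOn_iff S e f he, not_and] at hi
      by_cases h1 : Set.InjOn (compMap G (Set.subset_insert e S.edges)) S.colorX
      · rw [edgeMap_of_injOn he heS h1, map_smul, edgeMap_of_not_injOn (hi h1), smul_zero]
      · rw [edgeMap_of_not_injOn h1, map_zero]
    have inj : ∀ (F F' : Set β) (h : S.edges ⊆ F) (h' : S.edges ⊆ F'), F = F' →
        (Set.InjOn (compMap G h) S.colorX ↔ Set.InjOn (compMap G h') S.colorX) := by
      rintro F _ h h' rfl; rfl
    have inj' := inj _ _ ((Set.subset_insert e S.edges).trans (Set.subset_insert f _))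
      ((Set.subset_insert f S.edges).trans (Set.subset_insert e _)) (Set.insert_comm _ _ _)
    by_cases hi : Set.InjOn (compMap G
          (F' := insert f (insert e S.edges))
          ((Set.subset_insert _ _).trans (Set.subset_insert _ _))) S.colorX
    · rw [expand e f he hf heS hfS hef.ne hi, expand f e hf he hfS heS hef.ne' (inj'.1 hi),
        addEdge_comm S e f he hf, sign_aux _ (hE.subset S.edges_subset) e f heS hef, neg_smul,
        neg_neg]
    · rw [vanish e f he heS hi, vanish f e hf hfS (fun h => hi (inj'.2 h)), neg_zero]
  exact LinearMap.congr_fun key z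

theorem edgeMap_edgeMap (hE : E(G).Finite) {e f : β} (hef : e ≠ f) (z : CochainSpace G b) :
    edgeMap G b e (edgeMap G b f z) = - edgeMap G b f (edgeMap G b e z) := by
  rcases lt_or_gt_of_ne hef with h | h
  · exact edgeMap_edgeMap_of_lt hE h z
  · rw [edgeMap_edgeMap_of_lt hE h z, neg_neg]

theorem edgeMap_dOn (hE : E(G).Finite) {e : β} {D : Finset β} (he : e ∉ D)
    (z : CochainSpace G b) :
    edgeMap G b e (dOn G b D z) = - dOn G b D (edgeMap G b e z) := by
  rw [dOn, LinearMap.sum_apply, LinearMap.sum_apply, map_sum, ← Finset.sum_neg_distrib]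
  exact Finset.sum_congr rfl fun f hf =>
    edgeMap_edgeMap hE (by rintro rfl; exact he hf) z

theorem edgeMap_self (e : β) (z : CochainSpace G b) :
    edgeMap G b e (edgeMap G b e z) = 0 := by
  refine edgeMap_eq_zero (P := {S | e ∈ S.edges}) (fun S hS => Or.inl hS) ?_
  refine edgeMap_mem_stateSpan (P := Set.univ) (fun S _ he _ _ => Set.mem_insert _ _) ?_
  rw [stateSpan, Set.image_univ, (stateBasis G b).span_eq]
  trivial

theorem dOn_dOn (hE : E(G).Finite) (D : Finset β) (z : CochainSpace G b) :
    dOn G b D (dOn G b D z) = 0 := by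
  induction D using Finset.induction_on generalizing z with
  | empty => simp [dOn]
  | insert e D he ih =>
    have key (x : CochainSpace G b) :
        dOn G b (insert e D) x = edgeMap G b e x + dOn G b D x := by
      rw [dOn_eq_add (Finset.mem_insert_self e D), Finset.erase_insert he]
    rw [key, key, map_add, map_add, edgeMap_self, edgeMap_dOn hE he, ih]
    abel

end EdgeMaps

/-! ### Interval complexes and cancellation along one edge -/

section Vanishing

variable {α β : Type*} {G : Graph α β} {b : V(G)}

/-- The states of bidegree `(i, j)` with edge set between `A` and `A ∪ D` in which the components
of all vertices in `B` are coloured `x`. -/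
def intervalStates (G : Graph α β) (b : V(G)) (A : Set β) (D : Finset β) (B : Set V(G))
    (i j : ℤ) : Set (EnhancedState G b) :=
  {S | A ⊆ S.edges ∧ S.edges ⊆ A ∪ D ∧ (∀ v ∈ B, compOf G S.edges v ∈ S.colorX) ∧
    S.dim = i ∧ S.deg = j}

variable {A A' : Set β} {D D' : Finset β} {B : Set V(G)} {i j : ℤ} {e : β}

theorem dim_addEdge (hE : E(G).Finite) {S : EnhancedState G b} (he : e ∈ E(G))
    (heS : e ∉ S.edges) : (S.addEdge e he).dim = S.dim + 1 := by
  simp only [EnhancedState.dim, EnhancedState.addEdge]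
  rw [Set.ncard_insert_of_notMem heS (hE.subset S.edges_subset)]
  push_cast; rfl

theorem deg_addEdge {S : EnhancedState G b} (he : e ∈ E(G))
    (hi : Set.InjOn (compMap G (Set.subset_insert e S.edges)) S.colorX) :
    (S.addEdge e he).deg = S.deg := by
  simp only [EnhancedState.deg, EnhancedState.addEdge, hi.ncard_image]

theorem addEdge_mem_intervalStates (hE : E(G).Finite) {S : EnhancedState G b}
    (hS : S ∈ intervalStates G b A D B i j) (he : e ∈ E(G)) (heS : e ∉ S.edges)
    (hi : Set.InjOn (compMap G (Set.subset_insert e S.edges)) S.colorX)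
    (h₁ : A' ⊆ insert e S.edges) (h₂ : insert e S.edges ⊆ A' ∪ D') :
    S.addEdge e he ∈ intervalStates G b A' D' B (i + 1) j := by
  obtain ⟨-, -, hB, rfl, rfl⟩ := hS
  exact ⟨h₁, h₂, fun v hv => ⟨_, hB v hv, rfl⟩, dim_addEdge hE he heS, deg_addEdge he hi⟩

theorem edgeMap_mem_intervalStates [LinearOrder β] (hE : E(G).Finite)
    {z : CochainSpace G b} (hz : z ∈ stateSpan G b (intervalStates G b A D B i j))
    (h₁ : A' ⊆ insert e A) (h₂ : insert e (A ∪ D) ⊆ A' ∪ D') :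
    edgeMap G b e z ∈ stateSpan G b (intervalStates G b A' D' B (i + 1) j) :=
  edgeMap_mem_stateSpan (fun _ hS he heS hi => addEdge_mem_intervalStates hE hS he heS hi
    (h₁.trans (Set.insert_subset_insert hS.1))
    ((Set.insert_subset_insert hS.2.1).trans h₂)) hz

theorem dOn_mem_intervalStates [LinearOrder β] (hE : E(G).Finite)
    {z : CochainSpace G b} (hz : z ∈ stateSpan G b (intervalStates G b A D B i j)) :
    dOn G b D z ∈ stateSpan G b (intervalStates G b A D B (i + 1) j) := by
  rw [dOn, LinearMap.sum_apply]
  refine Submodule.sum_mem _ fun e he => edgeMap_mem_intervalStates hE hz (Set.subset_insert _ _) ?_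
  exact Set.insert_subset (Or.inr he) subset_rfl

theorem intervalStates_subset_union [LinearOrder β] :
    intervalStates G b A D B i j ⊆
      intervalStates G b A (D.erase e) B i j ∪ intervalStates G b (insert e A) (D.erase e) B i j := by
  intro S hS
  by_cases heS : e ∈ S.edges
  · refine Or.inr ⟨Set.insert_subset heS hS.1, fun f hf => ?_, hS.2.2⟩
    by_cases hfe : f = e
    · exact Or.inl (Or.inl hfe)
    · rcases hS.2.1 hf with h | h
      · exact Or.inl (Or.inr h)
      · exact Or.inr (by simp_all)
  · refine Or.inl ⟨hS.1, fun f hf => ?_, hS.2.2⟩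
    have hfe : f ≠ e := by rintro rfl; exact heS hf
    rcases hS.2.1 hf with h | h
    · exact Or.inl h
    · exact Or.inr (by simp_all)

theorem not_mem_edges_of_mem_intervalStates [LinearOrder β] (heA : e ∉ A)
    {S : EnhancedState G b} (hS : S ∈ intervalStates G b A (D.erase e) B i j) : e ∉ S.edges := by
  intro h
  rcases hS.2.1 h with h | h
  · exact heA h
  · simp at h

theorem disjoint_intervalStates [LinearOrder β] (heA : e ∉ A) {i' j' : ℤ} {B' : Set V(G)} :
    Disjoint (intervalStates G b A (D.erase e) B i j)
      (intervalStates G b (insert e A) D' B' i' j') := by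
  rw [Set.disjoint_left]
  intro S hS hS'
  exact not_mem_edges_of_mem_intervalStates heA hS (hS'.1 (Set.mem_insert _ _))

/-- A cocycle splits into its parts without and with the edge `e`. -/
theorem dOn_eq_zero_split [LinearOrder β] (hE : E(G).Finite) (heA : e ∉ A) (heD : e ∈ D)
    {x y : CochainSpace G b}
    (hx : x ∈ stateSpan G b (intervalStates G b A (D.erase e) B i j))
    (hy : y ∈ stateSpan G b (intervalStates G b (insert e A) (D.erase e) B i j))
    (h : dOn G b D (x + y) = 0) :
    dOn G b (D.erase e) x = 0 ∧ edgeMap G b e x + dOn G b (D.erase e) y = 0 := by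
  have hy0 : edgeMap G b e y = 0 :=
    edgeMap_eq_zero (fun S hS => Or.inl (hS.1 (Set.mem_insert _ _))) hy
  rw [dOn_eq_add heD, map_add, map_add, hy0] at h
  have h1 := dOn_mem_intervalStates hE hx
  have h2 := dOn_mem_intervalStates hE hy
  have h3 : edgeMap G b e x ∈ stateSpan G b
      (intervalStates G b (insert e A) (D.erase e) B (i + 1) j) :=
    edgeMap_mem_intervalStates hE hx subset_rfl (by rw [Set.insert_union])
  -- The left side is supported on states without `e` and the right side on states with `e`, so both
  -- vanish.
  have h4 : dOn G b (D.erase e) x = - (edgeMap G b e x + dOn G b (D.erase e) y) := by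
    rw [eq_neg_iff_add_eq_zero, ← h]; abel
  have h5 : dOn G b (D.erase e) x = 0 := by
    refine eq_zero_of_mem_stateSpan_of_mem_stateSpan
      (disjoint_intervalStates heA) h1 (Q := intervalStates G b (insert e A) (D.erase e) B (i + 1) j) ?_
    rw [h4]
    exact Submodule.neg_mem _ (Submodule.add_mem _ h3 h2)
  refine ⟨h5, ?_⟩
  rw [h5] at h4
  exact neg_eq_zero.1 h4.symm

/-- Distinct states of `Q` are sent, up to sign, to distinct basis vectors: the coordinate of `z` at
`S` is, up to sign, that of its image at `S.addEdge e he`. -/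
theorem eq_zero_of_edgeMap_eq_zero [LinearOrder β] {Q : Set (EnhancedState G b)} (he : e ∈ E(G))
    (heQ : ∀ S ∈ Q, e ∉ S.edges)
    (hi : ∀ S ∈ Q, Set.InjOn (compMap G (Set.subset_insert e S.edges)) S.colorX)
    (hinj : Set.InjOn (fun S : EnhancedState G b => S.addEdge e he) Q)
    {z : CochainSpace G b} (hz : z ∈ stateSpan G b Q) (h : edgeMap G b e z = 0) : z = 0 := by
  classical
  have coord (S : EnhancedState G b) : (stateBasis G b).coord S z = 0 := by
    by_cases hS : S ∈ Q
    · have key : ((stateBasis G b).coord (S.addEdge e he) ∘ₗ edgeMap G b e -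
          (-1 : ℝ) ^ {f ∈ S.edges | f < e}.ncard • (stateBasis G b).coord S) z ∈
          (⊥ : Submodule ℝ ℝ) := by
        refine map_mem_of_mem_stateSpan _ (fun S' hS' => ?_) hz
        rw [Submodule.mem_bot, LinearMap.sub_apply, LinearMap.comp_apply,
          edgeMap_of_injOn he (heQ S' hS') (hi S' hS')]
        by_cases hSS : S' = S
        · subst hSS
          simp
        · have : S'.addEdge e he ≠ S.addEdge e he := fun h' => hSS (hinj hS' hS h')
          simp [hSS, this]
      rw [Submodule.mem_bot, LinearMap.sub_apply, LinearMap.comp_apply, h, map_zero, zero_sub,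
        neg_eq_zero, LinearMap.smul_apply, smul_eq_mul] at key
      exact (mul_eq_zero.1 key).resolve_left (pow_ne_zero _ (by norm_num))
    · have key : (stateBasis G b).coord S z ∈ (⊥ : Submodule ℝ ℝ) := by
        refine map_mem_of_mem_stateSpan _ (fun S' hS' => ?_) hz
        have : S' ≠ S := by rintro rfl; exact hS hS'
        simp [this]
      simpa using key
  exact (stateBasis G b).forall_coord_eq_zero_iff.1 coord

theorem addEdge_injOn {Q : Set (EnhancedState G b)} (he : e ∈ E(G)) (heQ : ∀ S ∈ Q, e ∉ S.edges)
    (N : ∀ F : Set β, Set (Comp G F)) (hQ : ∀ S ∈ Q, S.colorX ⊆ N S.edges)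
    (hN : ∀ S ∈ Q, Set.InjOn (compMap G (Set.subset_insert e S.edges)) (N S.edges)) :
    Set.InjOn (fun S : EnhancedState G b => S.addEdge e he) Q := by
  intro S hS S' hS' h
  have heS := heQ S hS
  have heS' := heQ S' hS'
  have hSN := hQ S hS
  have hSN' := hQ S' hS'
  have hinj := hN S hS
  clear hS hS' hQ hN heQ
  obtain ⟨F, hF, X, hX⟩ := S
  obtain ⟨F', hF', X', hX'⟩ := S'
  have h1 : insert e F = insert e F' := congrArg EnhancedState.edges h
  have h2 : F = F' := by
    have := congrArg (· \ {e}) h1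
    simpa [Set.insert_sdiff_self_of_notMem heS, Set.insert_sdiff_self_of_notMem heS'] using this
  subst h2
  simp only [EnhancedState.addEdge, EnhancedState.mk.injEq, heq_eq_eq, true_and] at h
  simp only [EnhancedState.mk.injEq, heq_eq_eq, true_and]
  exact (hinj.image_eq_image_iff hSN hSN').1 h

/-- The colouring is pulled back along the bijection from `N` to the new components. The components
of `B`, in particular that of the base vertex, lie in `N` and so keep the colour `x`. -/
theorem exists_addEdge_eq [LinearOrder β] (hE : E(G).Finite) (he : e ∈ E(G)) (heA : e ∉ A)
    (hbB : b ∈ B) (N : ∀ F : Set β, Set (Comp G F))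
    (hN : ∀ F, A ⊆ F → F ⊆ A ∪ (D.erase e : Finset β) →
      Set.BijOn (compMap G (Set.subset_insert e F)) (N F) Set.univ)
    (hNB : ∀ F, A ⊆ F → F ⊆ A ∪ (D.erase e : Finset β) → ∀ v ∈ B, compOf G F v ∈ N F)
    {S' : EnhancedState G b} (hS' : S' ∈ intervalStates G b (insert e A) (D.erase e) B i j) :
    ∃ S ∈ intervalStates G b A (D.erase e) B (i - 1) j, S.colorX ⊆ N S.edges ∧
      S.addEdge e he = S' := by
  obtain ⟨F', hF', X', hb'⟩ := S'
  obtain ⟨hA, hD, hB, hi, hj⟩ := hS'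
  obtain ⟨F, heF, rfl⟩ : ∃ F, e ∉ F ∧ F' = insert e F :=
    ⟨F' \ {e}, by simp, by rw [Set.insert_sdiff_singleton, Set.insert_eq_of_mem (hA (Set.mem_insert _ _))]⟩
  simp only at hA hD hB
  have hAF : A ⊆ F := fun f hf => by
    rcases hA (Or.inr hf) with h | h
    · exact absurd (h ▸ hf) heA
    · exact h
  have hFD : F ⊆ A ∪ (D.erase e : Finset β) := fun f hf => by
    rcases hD (Or.inr hf) with (h | h) | h
    · exact absurd (h ▸ hf) heF
    · exact Or.inl h
    · exact Or.inr h
  have hbij := hN F hAF hFD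
  let S : EnhancedState G b := ⟨F, (Set.subset_insert e F).trans hF',
    N F ∩ compMap G (Set.subset_insert e F) ⁻¹' X', ⟨hNB F hAF hFD b hbB, hb'⟩⟩
  have hadd : S.addEdge e he = ⟨insert e F, hF', X', hb'⟩ := by
    simp only [S, EnhancedState.addEdge, EnhancedState.mk.injEq, heq_eq_eq, true_and]
    rw [Set.image_inter_preimage, hbij.image_eq, Set.univ_inter]
  refine ⟨S, ⟨hAF, hFD, fun v hv => ⟨hNB F hAF hFD v hv, hB v hv⟩, ?_, ?_⟩, Set.inter_subset_left,
    hadd⟩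
  · have := dim_addEdge hE (S := S) he heF
    rw [hadd, hi] at this
    omega
  · rw [← deg_addEdge (S := S) he (hbij.injOn.mono Set.inter_subset_left), hadd, hj]

/-- If adding `e` is a bijection from the states all of whose `x`-coloured components lie in `N`
to the states that contain `e`, and if adding `e` kills the other states, then each cocycle is
cohomologous to a cocycle supported on the killed states. -/
theorem exists_cohomologous [LinearOrder β] (hE : E(G).Finite) (he : e ∈ E(G)) (heA : e ∉ A)
    (heD : e ∈ D) (hbB : b ∈ B) (N : ∀ F : Set β, Set (Comp G F))
    (hN : ∀ F, A ⊆ F → F ⊆ A ∪ (D.erase e : Finset β) →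
      Set.BijOn (compMap G (Set.subset_insert e F)) (N F) Set.univ)
    (hNB : ∀ F, A ⊆ F → F ⊆ A ∪ (D.erase e : Finset β) → ∀ v ∈ B, compOf G F v ∈ N F)
    (hK : ∀ S ∈ intervalStates G b A (D.erase e) B i j, ¬ S.colorX ⊆ N S.edges →
      ¬ Set.InjOn (compMap G (Set.subset_insert e S.edges)) S.colorX)
    {z : CochainSpace G b} (hz : z ∈ stateSpan G b (intervalStates G b A D B i j))
    (hdz : dOn G b D z = 0) :
    ∃ y ∈ stateSpan G b (intervalStates G b A (D.erase e) B (i - 1) j),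
    ∃ k ∈ stateSpan G b {S ∈ intervalStates G b A (D.erase e) B i j | ¬ S.colorX ⊆ N S.edges},
      z = dOn G b D y + k ∧ dOn G b (D.erase e) k = 0 := by
  obtain ⟨z₀, hz₀, z₁, hz₁, rfl⟩ := exists_add_of_mem_stateSpan
    (intervalStates_subset_union (e := e)) hz
  -- The part of the cocycle that contains `e` is the `e`-part of a coboundary; subtracting this
  -- coboundary leaves a cochain without `e`.
  obtain ⟨y, hy, rfl⟩ : ∃ y ∈ stateSpan G b (intervalStates G b A (D.erase e) B (i - 1) j),
      edgeMap G b e y = z₁ := by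
    suffices h : stateSpan G b (intervalStates G b (insert e A) (D.erase e) B i j) ≤
        (stateSpan G b (intervalStates G b A (D.erase e) B (i - 1) j)).map (edgeMap G b e) from
      Submodule.mem_map.1 (h hz₁)
    refine Submodule.span_le.2 ?_
    rintro _ ⟨S', hS', rfl⟩
    obtain ⟨S, hS, hSN, rfl⟩ := exists_addEdge_eq hE he heA hbB N hN hNB hS'
    refine ⟨(-1 : ℝ) ^ {f ∈ S.edges | f < e}.ncard • stateBasis G b S,
      Submodule.smul_mem _ _ (mem_stateSpan hS), ?_⟩
    rw [map_smul, edgeMap_of_injOn he (not_mem_edges_of_mem_intervalStates heA hS)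
      ((hN _ hS.1 hS.2.1).injOn.mono hSN), smul_smul, ← mul_pow]
    simp
  obtain ⟨h1, h2⟩ := dOn_eq_zero_split hE heA heD hz₀ hz₁ hdz
  have hdy : dOn G b (D.erase e) y ∈ stateSpan G b (intervalStates G b A (D.erase e) B i j) := by
    simpa using dOn_mem_intervalStates hE hy
  have hx := Submodule.sub_mem _ hz₀ hdy
  -- The edge map anticommutes with the remaining differential, so this is the cocycle condition on
  -- the `e`-part.
  have hTx : edgeMap G b e (z₀ - dOn G b (D.erase e) y) = 0 := by
    rw [map_sub, edgeMap_dOn hE (by simp), sub_neg_eq_add, h2]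
  obtain ⟨q, hq, k, hk, hqk⟩ := exists_add_of_mem_stateSpan
    (Q := {S ∈ intervalStates G b A (D.erase e) B i j | S.colorX ⊆ N S.edges})
    (R := {S ∈ intervalStates G b A (D.erase e) B i j | ¬ S.colorX ⊆ N S.edges})
    (fun S hS => by
      by_cases h : S.colorX ⊆ N S.edges
      · exact Or.inl ⟨hS, h⟩
      · exact Or.inr ⟨hS, h⟩) hx
  have hTk : edgeMap G b e k = 0 := edgeMap_eq_zero (fun S hS => Or.inr (hK S hS.1 hS.2)) hk
  -- Adding `e` annihilates `q + k` and `k`, hence also `q`, but it is injective on the states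
  -- coloured inside `N`.
  have hq0 : q = 0 := by
    refine eq_zero_of_edgeMap_eq_zero he
      (fun S hS => not_mem_edges_of_mem_intervalStates heA hS.1)
      (fun S hS => (hN _ hS.1.1 hS.1.2.1).injOn.mono hS.2)
      (addEdge_injOn he (fun S hS => not_mem_edges_of_mem_intervalStates heA hS.1) N
        (fun S hS => hS.2) (fun S hS => (hN _ hS.1.1 hS.1.2.1).injOn)) hq ?_
    rw [← hqk, map_add, hTk, add_zero] at hTx
    exact hTx
  rw [hq0, zero_add] at hqk
  have hz' : z₀ + edgeMap G b e y = dOn G b D y + k := by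
    rw [dOn_eq_add heD, hqk]; abel
  refine ⟨y, hy, k, hk, hz', ?_⟩
  rw [hqk, map_sub, h1, dOn_dOn hE, sub_zero]

end Vanishing

/-! ### Vanishing off the diagonal -/

section Vanishing

variable {α β : Type*} {G : Graph α β} {b : V(G)}
  {A : Set β} {D : Finset β} {B : Set V(G)} {i j : ℤ}

theorem intervalStates_mono {D' : Finset β} {B' : Set V(G)} (hD : D' ⊆ D) (hB : B ⊆ B') :
    intervalStates G b A D' B' i j ⊆ intervalStates G b A D B i j := fun _ hS =>
  ⟨hS.1, hS.2.1.trans (Set.union_subset_union_right A (Finset.coe_subset.2 hD)),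
    fun v hv => hS.2.2.1 v (hB hv), hS.2.2.2⟩

/-- The source of the diagonal: with no free edges the only possible state has edge set `A` and, as
`B` meets every component, all components coloured `x`. It occupies a single bidegree. -/
theorem intervalStates_empty_eq_empty
    (hB : ∀ x, ∃ y ∈ B, compOf G A x = compOf G A y)
    (hij : i + j + 1 ≠ A.ncard + Nat.card (Comp G A)) :
    intervalStates G b A ∅ B i j = ∅ := by
  rw [Set.eq_empty_iff_forall_notMem]
  rintro ⟨F, hF, X, hX⟩ ⟨h1, h2, h3, h4, h5⟩
  obtain rfl : A = F := by
    refine subset_antisymm h1 ?_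
    simpa using h2
  have hX' : X = Set.univ := by
    refine Set.eq_univ_of_forall fun c => ?_
    obtain ⟨x, rfl⟩ := compOf_surjective _ c
    obtain ⟨y, hy, hxy⟩ := hB x
    rw [hxy]
    exact h3 y hy
  simp only [EnhancedState.dim, EnhancedState.deg, hX', Set.ncard_univ] at h4 h5
  omega

/-- Either some edge of `D` leads from the component of a vertex of `B` to another component of
`A`, or all edges of `D` join vertices in the same component of `A`. -/
theorem compOf_eq_of_forall_not_leaving
    (hB : ∀ x, ∃ y ∈ B, compOf G (A ∪ D) x = compOf G (A ∪ D) y)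
    (h : ∀ e ∈ D, ∀ u v : V(G), G.IsLink e u.1 v.1 → ∀ w ∈ B, compOf G A u = compOf G A w →
      compOf G A u = compOf G A v) :
    ∀ e ∈ D, ∀ u v : V(G), G.IsLink e u.1 v.1 → compOf G A u = compOf G A v := by
  intro e he u v huv
  obtain ⟨w, hw, huw⟩ := hB u
  have hvw : compOf G (A ∪ D) v = compOf G (A ∪ D) w :=
    (compOf_eq_of_isLink (Set.mem_union_right A he) huv).symm.trans huw
  -- As no edge of `D` leaves the component of `w` in `A`, this component is already a full
  -- component of `A ∪ D`.
  have key : ∀ f ∈ A ∪ (D : Set β), ∀ x y : V(G), G.IsLink f x.1 y.1 →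
      (compOf G A x = compOf G A w) = (compOf G A y = compOf G A w) := by
    rintro f (hf | hf) x y hxy
    · rw [compOf_eq_of_isLink hf hxy]
    · apply propext
      constructor
      · intro hx
        rw [← h f hf x y hxy w hw hx, hx]
      · intro hy
        rw [← h f hf y x hxy.symm w hw hy, hy]
  have hu := eq_of_compOf_eq key huw
  have hv := eq_of_compOf_eq key hvw
  rw [of_eq_true (hu.trans (eq_self _)), of_eq_true (hv.trans (eq_self _))]

variable [LinearOrder β]

theorem union_eq_insert_union_erase {e : β} (heD : e ∈ D) :
    A ∪ (D : Set β) = insert e (A ∪ (D.erase e : Finset β)) := by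
  ext f
  simp only [Set.mem_union, Set.mem_insert_iff, Finset.mem_coe, Finset.mem_erase]
  by_cases h : f = e <;> simp [h, heD]

/-- The complex of the states with edge sets between `A` and `A ∪ D` whose `B`-components are
coloured `x` is exact off one diagonal, if `B` meets each component of `A ∪ D` exactly once. -/
theorem exists_dOn_eq [Finite V(G)] (hE : E(G).Finite) (hD : (D : Set β) ⊆ E(G))
    (hA : A ⊆ E(G)) (hAD : ∀ e ∈ D, e ∉ A) (hb : b ∈ B)
    (hB : ∀ x, ∃ y ∈ B, compOf G (A ∪ D) x = compOf G (A ∪ D) y)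
    (hB' : ∀ x ∈ B, ∀ y ∈ B, compOf G (A ∪ D) x = compOf G (A ∪ D) y → x = y)
    (hij : i + j + 1 ≠ A.ncard + Nat.card (Comp G A)) {z : CochainSpace G b}
    (hz : z ∈ stateSpan G b (intervalStates G b A D B i j)) (hdz : dOn G b D z = 0) :
    ∃ w ∈ stateSpan G b (intervalStates G b A D B (i - 1) j), dOn G b D w = z := by
  induction hn : D.card generalizing A B D i z with
  | zero =>
    obtain rfl := Finset.card_eq_zero.1 hn
    rw [Finset.coe_empty, Set.union_empty] at hB
    rw [intervalStates_empty_eq_empty hB hij, stateSpan_empty, Submodule.mem_bot] at hz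
    exact ⟨0, Submodule.zero_mem _, by rw [map_zero, hz]⟩
  | succ n ih =>
    have herase {e : β} (he : e ∈ D) : (D.erase e).card = n := by
      rw [Finset.card_erase_of_mem he, hn, Nat.add_sub_cancel]
    have hsub {e : β} : ((D.erase e : Finset β) : Set β) ⊆ E(G) :=
      (Finset.coe_subset.2 (Finset.erase_subset e D)).trans hD
    -- If no edge leaves, adding any `e ∈ D` is a bijection on components. Cancellation applies with
    -- `N` everything, no state is killed, and the complex is acyclic in every bidegree.
    by_cases hleave : ∀ e ∈ D, ∀ u v : V(G), G.IsLink e u.1 v.1 → ∀ w ∈ B,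
        compOf G A u = compOf G A w → compOf G A u = compOf G A v
    · obtain ⟨e, heD⟩ : D.Nonempty := by rw [← Finset.card_pos]; omega
      obtain ⟨u, v, huv⟩ := Graph.exists_isLink_of_mem_edgeSet (hD heD)
      have huv' := compOf_eq_of_forall_not_leaving hB hleave e heD ⟨u, huv.left_mem⟩
        ⟨v, huv.right_mem⟩ huv
      obtain ⟨y, hy, k, hk, hzk, -⟩ := exists_cohomologous hE (hD heD) (hAD e heD) heD hb
        (fun _ => Set.univ)
        (fun F hF _ => bijOn_compMap_of_eq (u := ⟨u, huv.left_mem⟩) (v := ⟨v, huv.right_mem⟩) huv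
          (compOf_eq_mono hF huv'))
        (fun _ _ _ _ _ => trivial) (fun S _ h => absurd (Set.subset_univ _) h) hz hdz
      have hk0 : k = 0 := by
        have : {S ∈ intervalStates G b A (D.erase e) B i j | ¬ S.colorX ⊆ Set.univ} = ∅ := by
          simp
        rw [this, stateSpan_empty, Submodule.mem_bot] at hk
        exact hk
      refine ⟨y, stateSpan_mono (intervalStates_mono (Finset.erase_subset e D) subset_rfl) hy, ?_⟩
      rw [hzk, hk0, add_zero]
    · push Not at hleave
      obtain ⟨e, heD, u, v, huv, w, hw, huw, hne⟩ := hleave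
      have heA := hAD e heD
      have hU := union_eq_insert_union_erase (A := A) heD
      -- When `e` is not a bridge of `A ∪ D`, both smaller complexes keep `B` as transversal. A
      -- primitive `w₀` is found for the part without `e`, then the part with `e` is corrected by
      -- the image of `w₀`.
      by_cases hconn : compOf G (A ∪ (D.erase e : Finset β)) u =
          compOf G (A ∪ (D.erase e : Finset β)) v
      · obtain ⟨z₀, hz₀, z₁, hz₁, rfl⟩ := exists_add_of_mem_stateSpan
          (intervalStates_subset_union (e := e)) hz
        obtain ⟨h1, h2⟩ := dOn_eq_zero_split hE heA heD hz₀ hz₁ hdz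
        obtain ⟨w₀, hw₀, rfl⟩ := ih hsub hA (fun f hf => hAD f (Finset.mem_of_mem_erase hf)) hb
          (fun x => by
            obtain ⟨y, hy, hxy⟩ := hB x
            rw [hU] at hxy
            exact ⟨y, hy, compOf_insert_eq_of_eq huv hconn hxy⟩)
          (fun x hx y hy hxy => hB' x hx y hy (by
            rw [hU]; exact compOf_eq_mono (Set.subset_insert _ _) hxy)) hij hz₀ h1 (herase heD)
        have hU' : insert e A ∪ ((D.erase e : Finset β) : Set β) = A ∪ D := by
          rw [hU, Set.insert_union]
        have hcard := card_comp_insert huv hne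
        have hTw : edgeMap G b e w₀ ∈ stateSpan G b
            (intervalStates G b (insert e A) (D.erase e) B i j) := by
          simpa using edgeMap_mem_intervalStates (A' := insert e A) (D' := D.erase e) hE hw₀
            subset_rfl (by rw [Set.insert_union])
        obtain ⟨w₁, hw₁, hdw₁⟩ := ih (A := insert e A) (z := z₁ - edgeMap G b e w₀) hsub
          (Set.insert_subset (hD heD) hA)
          (fun f hf => by
            have := Finset.mem_erase.1 hf
            rintro (h | h)
            · exact this.1 h
            · exact hAD f this.2 h) hb (by rwa [hU']) (by rwa [hU'])
          (by
            rw [Set.ncard_insert_of_notMem heA (hE.subset hA)]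
            push_cast
            omega)
          (Submodule.sub_mem _ hz₁ hTw)
          (by
            rw [map_sub, sub_eq_add_neg, ← edgeMap_dOn hE (by simp), add_comm]
            exact h2) (herase heD)
        have hTw₁ : edgeMap G b e w₁ = 0 :=
          edgeMap_eq_zero (fun S hS => Or.inl (hS.1 (Set.mem_insert _ _))) hw₁
        refine ⟨w₀ + w₁, Submodule.add_mem _
          (stateSpan_mono (intervalStates_mono (Finset.erase_subset e D) subset_rfl) hw₀)
          (stateSpan_mono ?_ hw₁), ?_⟩
        · intro S hS
          exact ⟨(Set.subset_insert e A).trans hS.1, hU' ▸ hS.2.1, hS.2.2⟩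
        rw [dOn_eq_add heD, map_add, map_add, hTw₁, hdw₁]
        abel
      · have hneF {F : Set β} (hF : F ⊆ A ∪ (D.erase e : Finset β)) :
            compOf G F u ≠ compOf G F v := fun h => hconn (compOf_eq_mono hF h)
        -- Here `e` is a bridge. The component of `A ∪ D` containing `e` meets `B` only in `w`,
        -- which lies on the side of `u`; hence the side of `v` misses `B`.
        have hvB : ∀ x ∈ B, compOf G (A ∪ (D.erase e : Finset β)) x ≠
            compOf G (A ∪ (D.erase e : Finset β)) v := by
          intro x hx hxv
          have hxw : compOf G (A ∪ D) x = compOf G (A ∪ D) w := by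
            refine Eq.trans ?_ (compOf_eq_mono Set.subset_union_left huw)
            rw [compOf_eq_of_isLink (Set.mem_union_right A heD) huv, hU]
            exact compOf_eq_mono (Set.subset_insert _ _) hxv
          rw [hB' x hx w hw hxw] at hxv
          exact hconn ((compOf_eq_mono Set.subset_union_left huw).trans hxv)
        -- The component of `u` contains `w` and is coloured `x`, so if that of `v` is too, adding
        -- `e` multiplies `x` by `x`.
        have hkill : ∀ i, ∀ S ∈ intervalStates G b A (D.erase e) B i j,
            compOf G S.edges v ∈ S.colorX →
            ¬ Set.InjOn (compMap G (Set.subset_insert e S.edges)) S.colorX := by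
          intro i S hS hv hinj
          refine hneF hS.2.1 (hinj ?_ hv ?_)
          · rw [compOf_eq_mono hS.1 huw]
            exact hS.2.2.1 w hw
          · exact compOf_eq_of_isLink (Set.mem_insert _ _) huv
        have hmem : ∀ S : EnhancedState G b, ¬ S.colorX ⊆ {c | c ≠ compOf G S.edges v} →
            compOf G S.edges v ∈ S.colorX := by
          intro S h
          by_contra hv
          exact h fun c hc hcv => hv (hcv ▸ hc)
        obtain ⟨y, hy, k, hk, hzk, hdk⟩ := exists_cohomologous hE (hD heD) heA heD hb
          (fun F => {c | c ≠ compOf G F v})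
          (fun F _ hF => bijOn_compMap_of_ne huv (hneF hF))
          (fun F _ hF x hx h => hvB x hx (compOf_eq_mono hF h))
          (fun S hS h => hkill i S hS (hmem S h)) hz hdz
        have hk' : k ∈ stateSpan G b (intervalStates G b A (D.erase e) (insert v B) i j) := by
          refine stateSpan_mono ?_ hk
          intro S hS
          refine ⟨hS.1.1, hS.1.2.1, ?_, hS.1.2.2.2⟩
          rintro x (rfl | hx)
          · exact hmem S hS.2
          · exact hS.1.2.2.1 x hx
        obtain ⟨w', hw', hdw'⟩ := ih (B := insert v B) hsub hA
          (fun f hf => hAD f (Finset.mem_of_mem_erase hf)) (Or.inr hb)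
          (fun x => by
            obtain ⟨y, hy, hxy⟩ := hB x
            rw [hU] at hxy
            rcases compOf_insert_eq huv hxy with h | h | h
            · exact ⟨y, Or.inr hy, h⟩
            · exact ⟨w, Or.inr hw, h.1.trans (compOf_eq_mono Set.subset_union_left huw)⟩
            · exact ⟨v, Or.inl rfl, h.1⟩)
          (by
            rintro x (rfl | hx) y (rfl | hy) hxy
            · rfl
            · exact absurd hxy.symm (hvB y hy)
            · exact absurd hxy (hvB x hx)
            · exact hB' x hx y hy (by
                rw [hU]; exact compOf_eq_mono (Set.subset_insert _ _) hxy)) hij hk' hdk (herase heD)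
        -- The primitive of `k` also consists of killed states, so restoring `e` to the differential
        -- does not change its image.
        have hTw' : edgeMap G b e w' = 0 :=
          edgeMap_eq_zero (fun S hS => Or.inr (hkill (i - 1) S
            (intervalStates_mono subset_rfl (Set.subset_insert v B) hS)
            (hS.2.2.1 v (Or.inl rfl)))) hw'
        refine ⟨y + w', Submodule.add_mem _
          (stateSpan_mono (intervalStates_mono (Finset.erase_subset e D) subset_rfl) hy)
          (stateSpan_mono (intervalStates_mono (Finset.erase_subset e D)
            (Set.subset_insert v B)) hw'), ?_⟩
        rw [map_add, dOn_eq_add heD w', hTw', zero_add, hdw', hzk]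

/-- The reduced chromatic cohomology of a connected graph with `n` vertices vanishes off the
diagonal `i + j = n - 1`. -/
theorem cocycles_le_coboundaries [Finite V(G)] (hE : E(G).Finite)
    (hG : ∀ x y, compOf G E(G) x = compOf G E(G) y)
    (hij : i + j + 1 ≠ Nat.card V(G)) : cocycles G b i j ≤ coboundaries G b i j := by
  -- The full complex is the case `A = ∅`, `D = E(G)`, `B = {b}`; connectedness makes `{b}` a
  -- transversal.
  have hst (i : ℤ) : intervalStates G b ∅ hE.toFinset {b} i j = {S | S.dim = i ∧ S.deg = j} := by
    ext S
    simp [intervalStates, S.edges_subset, S.base_mem]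
  rintro z ⟨hz, hdz⟩
  replace hdz : dOn G b hE.toFinset z = 0 := by rw [← d_eq_dOn hE]; exact hdz
  have hcard : Nat.card (Comp G ∅) = Nat.card V(G) :=
    (Nat.card_congr (Equiv.ofBijective _ ⟨compOf_empty_injective, compOf_surjective ∅⟩)).symm
  obtain ⟨w, hw, rfl⟩ := exists_dOn_eq (A := ∅) (B := {b}) (i := i) (j := j) hE
    (by simp) (Set.empty_subset _) (by simp) rfl
    (fun x => ⟨b, rfl, by rw [Set.empty_union, hE.coe_toFinset]; exact hG x b⟩)
    (fun x hx y hy _ => hx.trans hy.symm) (by simpa [hcard] using hij)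
    (by rw [hst]; exact hz) hdz
  rw [hst] at hw
  exact ⟨w, hw, by rw [d_eq_dOn hE]⟩

end Vanishing

/-! ### Whitney twists preserve the number of components -/

section Twist

/-- The map on components given by a function on the vertices that takes equal values at the ends
of each edge. -/
def compLift {α β : Type*} {G : Graph α β} {F : Set β} {γ : Type*} (f : V(G) → γ)
    (hf : ∀ e ∈ F, ∀ x y : V(G), G.IsLink e x.1 y.1 → f x = f y) : Comp G F → γ :=
  Quot.lift f fun _ _ h => eq_of_compOf_eq hf (Quot.sound h)

theorem compLift_compOf {α β : Type*} {G : Graph α β} {F : Set β} {γ : Type*} (f : V(G) → γ)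
    (hf : ∀ e ∈ F, ∀ x y : V(G), G.IsLink e x.1 y.1 → f x = f y) (x : V(G)) :
    compLift f hf (compOf G F x) = f x := rfl

theorem GraphIso.nonempty_comp_equiv {α β α' β' : Type*} {G : Graph α β} {G' : Graph α' β'}
    (φ : GraphIso G G') {F : Set β} {F' : Set β'}
    (h : ∀ e : E(G), e.1 ∈ F ↔ (φ.edgeEquiv e).1 ∈ F') : Nonempty (Comp G F ≃ Comp G' F') := by
  have hlink (e : E(G)) (x y : V(G')) : G.IsLink e.1 (φ.vertexEquiv.symm x).1
      (φ.vertexEquiv.symm y).1 ↔ G'.IsLink (φ.edgeEquiv e).1 x.1 y.1 := by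
    rw [← φ.isLink_iff, Equiv.apply_symm_apply, Equiv.apply_symm_apply]
  refine ⟨⟨compLift (fun x => compOf G' F' (φ.vertexEquiv x)) ?_,
    compLift (fun x => compOf G F (φ.vertexEquiv.symm x)) ?_, ?_, ?_⟩⟩
  · intro e he x y hxy
    exact compOf_eq_of_isLink ((h ⟨e, hxy.edge_mem⟩).1 he)
      ((φ.isLink_iff ⟨e, hxy.edge_mem⟩ x y).2 hxy)
  · intro e he x y hxy
    obtain ⟨f, hf⟩ := φ.edgeEquiv.surjective ⟨e, hxy.edge_mem⟩
    have hf' : (φ.edgeEquiv f).1 = e := congrArg Subtype.val hf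
    subst hf'
    exact compOf_eq_of_isLink ((h f).2 he) ((hlink f x y).2 hxy)
  · intro c
    obtain ⟨x, rfl⟩ := compOf_surjective _ c
    simp [compLift_compOf]
  · intro c
    obtain ⟨x, rfl⟩ := compOf_surjective _ c
    simp [compLift_compOf]

theorem glueRel_iff {α₁ α₂ : Type*} {a b : α₁} {c d : α₂} {x y : α₁ ⊕ α₂} :
    GlueRel a b c d x y ↔ (x = Sum.inl a ∧ y = Sum.inr c) ∨ (x = Sum.inl b ∧ y = Sum.inr d) := by
  constructor
  · rintro (_ | _) <;> simp
  · rintro (⟨rfl, rfl⟩ | ⟨rfl, rfl⟩)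
    · exact .fst
    · exact .snd

open Classical in
/-- Exchanging `c` and `d` identifies the two ways of gluing. -/
theorem nonempty_quot_glueRel_equiv {α₁ α₂ : Type*} (a b : α₁) (c d : α₂) :
    Nonempty (Quot (GlueRel a b c d) ≃ Quot (GlueRel a b d c)) := by
  refine ⟨Quot.congr (Equiv.sumCongr (Equiv.refl _) (Equiv.swap c d)) fun x y => ?_⟩
  rw [glueRel_iff, glueRel_iff]
  rcases x with x | x <;> rcases y with y | y <;>
    simp only [Equiv.sumCongr_apply, Sum.map_inl, Sum.map_inr, Equiv.coe_refl, id, reduceCtorEq,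
      Sum.inl.injEq, Sum.inr.injEq, Equiv.swap_apply_eq_iff, Equiv.swap_apply_left,
      Equiv.swap_apply_right, and_false, false_and]

variable {α₁ β₁ α₂ β₂ : Type*} {G₁ : Graph α₁ β₁} {G₂ : Graph α₂ β₂}
  {e₁ : β₁} {u₁ v₁ : α₁} {e₂ : β₂} {u₂ v₂ : α₂}

/-- The graph obtained by gluing two edges and removing the resulting edge. -/
abbrev twoSum (G₁ : Graph α₁ β₁) (G₂ : Graph α₂ β₂) (e₁ : β₁) (e₂ : β₂) (u₁ v₁ : α₁)
    (u₂ v₂ : α₂) : Graph (Quot (GlueRel u₁ v₁ u₂ v₂)) (β₁ ⊕ β₂) :=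
  (edgeGluing G₁ G₂ e₂ u₁ v₁ u₂ v₂).deleteEdges {Sum.inl e₁}

/-- Gluing acts on vertices only, so the identity on edges matches the two ways of gluing. -/
theorem edgeSet_twoSum_comm :
    E(twoSum G₁ G₂ e₁ e₂ u₁ v₁ u₂ v₂) = E(twoSum G₁ G₂ e₁ e₂ u₁ v₁ v₂ u₂) := rfl

theorem mem_vertexSet_twoSum {p : Quot (GlueRel u₁ v₁ u₂ v₂)} :
    p ∈ V(twoSum G₁ G₂ e₁ e₂ u₁ v₁ u₂ v₂) ↔
      (∃ a ∈ V(G₁), p = Quot.mk _ (Sum.inl a)) ∨ (∃ a ∈ V(G₂), p = Quot.mk _ (Sum.inr a)) := by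
  change p ∈ Quot.mk _ '' (Sum.inl '' V(G₁) ∪ Sum.inr '' V(G₂)) ↔ _
  constructor
  · rintro ⟨_, ⟨a, ha, rfl⟩ | ⟨a, ha, rfl⟩, rfl⟩
    · exact Or.inl ⟨a, ha, rfl⟩
    · exact Or.inr ⟨a, ha, rfl⟩
  · rintro (⟨a, ha, rfl⟩ | ⟨a, ha, rfl⟩)
    · exact ⟨_, Or.inl ⟨a, ha, rfl⟩, rfl⟩
    · exact ⟨_, Or.inr ⟨a, ha, rfl⟩, rfl⟩

theorem isLink_twoSum {e : β₁ ⊕ β₂} {p q : Quot (GlueRel u₁ v₁ u₂ v₂)} :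
    (twoSum G₁ G₂ e₁ e₂ u₁ v₁ u₂ v₂).IsLink e p q ↔
      (∃ f a c, f ≠ e₁ ∧ G₁.IsLink f a c ∧ e = Sum.inl f ∧ p = Quot.mk _ (Sum.inl a) ∧
        q = Quot.mk _ (Sum.inl c)) ∨
      (∃ f a c, f ≠ e₂ ∧ G₂.IsLink f a c ∧ e = Sum.inr f ∧ p = Quot.mk _ (Sum.inr a) ∧
        q = Quot.mk _ (Sum.inr c)) := by
  simp only [twoSum, edgeGluing, Graph.deleteEdges_isLink, Graph.map_isLink, Relation.Map]
  constructor
  · rintro ⟨⟨_, _, ⟨⟨f, a, c, h, rfl, rfl, rfl⟩ | ⟨f, a, c, h, rfl, rfl, rfl⟩, h2⟩, rfl, rfl⟩, h3⟩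
    · exact Or.inl ⟨f, a, c, by simpa using h3, h, rfl, rfl, rfl⟩
    · exact Or.inr ⟨f, a, c, by simpa using h2, h, rfl, rfl, rfl⟩
  · rintro (⟨f, a, c, hf, h, rfl, rfl, rfl⟩ | ⟨f, a, c, hf, h, rfl, rfl, rfl⟩)
    · exact ⟨⟨_, _, ⟨Or.inl ⟨f, a, c, h, rfl, rfl, rfl⟩, by simp⟩, rfl, rfl⟩, by simpa using hf⟩
    · exact ⟨⟨_, _, ⟨Or.inr ⟨f, a, c, h, rfl, rfl, rfl⟩, by simpa using hf⟩, rfl, rfl⟩, by simp⟩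

open Classical in
/-- The components of a state of a 2-sum are obtained from the components of the two parts by
gluing the components of the ends of the two edges. -/
theorem nonempty_comp_twoSum_equiv (hu₁ : u₁ ∈ V(G₁)) (hv₁ : v₁ ∈ V(G₁)) (hu₂ : u₂ ∈ V(G₂))
    (hv₂ : v₂ ∈ V(G₂)) {F : Set (β₁ ⊕ β₂)} (h₁ : Sum.inl e₁ ∉ F) (h₂ : Sum.inr e₂ ∉ F) :
    Nonempty (Comp (twoSum G₁ G₂ e₁ e₂ u₁ v₁ u₂ v₂) F ≃
      Quot (GlueRel (compOf G₁ (Sum.inl ⁻¹' F) ⟨u₁, hu₁⟩) (compOf G₁ (Sum.inl ⁻¹' F) ⟨v₁, hv₁⟩)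
        (compOf G₂ (Sum.inr ⁻¹' F) ⟨u₂, hu₂⟩) (compOf G₂ (Sum.inr ⁻¹' F) ⟨v₂, hv₂⟩))) := by
  set H := twoSum G₁ G₂ e₁ e₂ u₁ v₁ u₂ v₂
  set R := GlueRel (compOf G₁ (Sum.inl ⁻¹' F) ⟨u₁, hu₁⟩) (compOf G₁ (Sum.inl ⁻¹' F) ⟨v₁, hv₁⟩)
        (compOf G₂ (Sum.inr ⁻¹' F) ⟨u₂, hu₂⟩) (compOf G₂ (Sum.inr ⁻¹' F) ⟨v₂, hv₂⟩)
  -- The value at elements of `α₁` that are not vertices is arbitrary; the component of `u₁` serves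
  -- as default.
  let g₁ : α₁ → Quot R := fun a =>
    Quot.mk R (Sum.inl (compOf G₁ (Sum.inl ⁻¹' F) (if h : a ∈ V(G₁) then ⟨a, h⟩ else ⟨u₁, hu₁⟩)))
  let g₂ : α₂ → Quot R := fun a =>
    Quot.mk R (Sum.inr (compOf G₂ (Sum.inr ⁻¹' F) (if h : a ∈ V(G₂) then ⟨a, h⟩ else ⟨u₂, hu₂⟩)))
  let g : Quot (GlueRel u₁ v₁ u₂ v₂) → Quot R := Quot.lift (Sum.elim g₁ g₂) (by
    rintro _ _ (_ | _)
    · simp only [Sum.elim_inl, Sum.elim_inr, g₁, g₂, dif_pos hu₁, dif_pos hu₂]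
      exact Quot.sound .fst
    · simp only [Sum.elim_inl, Sum.elim_inr, g₁, g₂, dif_pos hv₁, dif_pos hv₂]
      exact Quot.sound .snd)
  have hV₁ (a : V(G₁)) : Quot.mk _ (Sum.inl a.1) ∈ V(H) :=
    mem_vertexSet_twoSum.2 (Or.inl ⟨a.1, a.2, rfl⟩)
  have hV₂ (a : V(G₂)) : Quot.mk _ (Sum.inr a.1) ∈ V(H) :=
    mem_vertexSet_twoSum.2 (Or.inr ⟨a.1, a.2, rfl⟩)
  refine ⟨⟨compLift (fun x => g x.1) ?_, Quot.lift (Sum.elim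
    (compLift (fun a => compOf H F ⟨_, hV₁ a⟩) ?_)
    (compLift (fun a => compOf H F ⟨_, hV₂ a⟩) ?_)) ?_, ?_, ?_⟩⟩
  · rintro e he ⟨x, hx⟩ ⟨y, hy⟩ hxy
    rcases isLink_twoSum.1 hxy with ⟨f, a, c, hf, h, rfl, rfl, rfl⟩ |
      ⟨f, a, c, hf, h, rfl, rfl, rfl⟩
    · simp only [g, Sum.elim_inl, g₁, dif_pos h.left_mem, dif_pos h.right_mem]
      rw [compOf_eq_of_isLink (G := G₁) (F := Sum.inl ⁻¹' F) (u := ⟨a, h.left_mem⟩)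
        (v := ⟨c, h.right_mem⟩) he h]
    · simp only [g, Sum.elim_inr, g₂, dif_pos h.left_mem, dif_pos h.right_mem]
      rw [compOf_eq_of_isLink (G := G₂) (F := Sum.inr ⁻¹' F) (u := ⟨a, h.left_mem⟩)
        (v := ⟨c, h.right_mem⟩) he h]
  · intro f hf x y hxy
    refine compOf_eq_of_isLink (F := F) hf (isLink_twoSum.2 (Or.inl ⟨f, x.1, y.1, ?_, hxy, rfl, rfl, rfl⟩))
    rintro rfl
    exact h₁ hf
  · intro f hf x y hxy
    refine compOf_eq_of_isLink (F := F) hf (isLink_twoSum.2 (Or.inr ⟨f, x.1, y.1, ?_, hxy, rfl, rfl, rfl⟩))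
    rintro rfl
    exact h₂ hf
  · rintro _ _ (_ | _)
    · simp only [Sum.elim_inl, Sum.elim_inr, compLift_compOf]
      exact congrArg _ (Subtype.ext (Quot.sound .fst))
    · simp only [Sum.elim_inl, Sum.elim_inr, compLift_compOf]
      exact congrArg _ (Subtype.ext (Quot.sound .snd))
  · intro c
    obtain ⟨⟨x, hx⟩, rfl⟩ := compOf_surjective _ c
    rcases mem_vertexSet_twoSum.1 hx with ⟨a, ha, rfl⟩ | ⟨a, ha, rfl⟩
    · simp only [compLift_compOf, g, Sum.elim_inl, g₁, dif_pos ha]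
    · simp only [compLift_compOf, g, Sum.elim_inr, g₂, dif_pos ha]
  · intro q
    obtain ⟨c | c, rfl⟩ := Quot.exists_rep q
    · obtain ⟨a, rfl⟩ := compOf_surjective _ c
      simp only [Sum.elim_inl, compLift_compOf, g, g₁, dif_pos a.2]
    · obtain ⟨a, rfl⟩ := compOf_surjective _ c
      simp only [Sum.elim_inr, compLift_compOf, g, g₂, dif_pos a.2]

/-- Both component sets are quotients of the same disjoint union, and they differ by exchanging the
components of `u₂` and `v₂`. Compatibility with adding edges is not needed, since only cardinalities
are used. -/
theorem nonempty_comp_twoSum_comm (hu₁ : u₁ ∈ V(G₁)) (hv₁ : v₁ ∈ V(G₁)) (hu₂ : u₂ ∈ V(G₂))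
    (hv₂ : v₂ ∈ V(G₂)) {F : Set (β₁ ⊕ β₂)} (h₁ : Sum.inl e₁ ∉ F) (h₂ : Sum.inr e₂ ∉ F) :
    Nonempty (Comp (twoSum G₁ G₂ e₁ e₂ u₁ v₁ u₂ v₂) F ≃
      Comp (twoSum G₁ G₂ e₁ e₂ u₁ v₁ v₂ u₂) F) := by
  obtain ⟨θ⟩ := nonempty_comp_twoSum_equiv hu₁ hv₁ hu₂ hv₂ h₁ h₂
  obtain ⟨θ'⟩ := nonempty_comp_twoSum_equiv hu₁ hv₁ hv₂ hu₂ h₁ h₂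
  obtain ⟨κ⟩ := nonempty_quot_glueRel_equiv (compOf G₁ (Sum.inl ⁻¹' F) ⟨u₁, hu₁⟩)
    (compOf G₁ (Sum.inl ⁻¹' F) ⟨v₁, hv₁⟩) (compOf G₂ (Sum.inr ⁻¹' F) ⟨u₂, hu₂⟩)
    (compOf G₂ (Sum.inr ⁻¹' F) ⟨v₂, hv₂⟩)
  exact ⟨θ.trans (κ.trans θ'.symm)⟩

/-- The states of two graphs that are related by a Whitney twist correspond to each other, such
that the numbers of edges and of components are preserved. -/
theorem IsWhitneyTwist.exists_edges_equiv {α β α' β' : Type*} {Γ : Graph α β} {Γ' : Graph α' β'}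
    (h : IsWhitneyTwist.{w} Γ Γ') :
    ∃ σ : E(Γ) ≃ E(Γ'), ∀ (F : Set β) (F' : Set β'), (∀ e : E(Γ), e.1 ∈ F ↔ (σ e).1 ∈ F') →
      Nonempty (Comp Γ F ≃ Comp Γ' F') := by
  obtain ⟨α₁, β₁, α₂, β₂, G₁, G₂, e₁, u₁, v₁, e₂, u₂, v₂, h₁, -, h₂, -, ⟨φ⟩, ⟨φ'⟩⟩ := h
  refine ⟨φ.edgeEquiv.trans ((Equiv.setCongr edgeSet_twoSum_comm).trans φ'.edgeEquiv.symm),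
    fun F F' hF => ?_⟩
  let K : Set (β₁ ⊕ β₂) := {k | ∃ e : E(Γ), e.1 ∈ F ∧ (φ.edgeEquiv e).1 = k}
  have hK : ∀ k ∈ K, k ≠ Sum.inl e₁ ∧ k ≠ Sum.inr e₂ := by
    rintro _ ⟨e, -, rfl⟩
    obtain ⟨x, y, hxy⟩ := Graph.exists_isLink_of_mem_edgeSet (φ.edgeEquiv e).2
    rcases isLink_twoSum.1 hxy with ⟨f, a, c, hf, -, hef, -⟩ | ⟨f, a, c, hf, -, hef, -⟩
    · rw [hef]; simpa using hf
    · rw [hef]; simpa using hf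
  have hφ (e : E(Γ)) : e.1 ∈ F ↔ (φ.edgeEquiv e).1 ∈ K := by
    refine ⟨fun h => ⟨e, h, rfl⟩, ?_⟩
    rintro ⟨f, hf, hfe⟩
    rwa [← φ.edgeEquiv.injective (Subtype.ext hfe)]
  obtain ⟨θ⟩ := φ.nonempty_comp_equiv hφ
  obtain ⟨κ⟩ := nonempty_comp_twoSum_comm h₁.left_mem h₁.right_mem h₂.left_mem h₂.right_mem
    (F := K) (fun h => (hK _ h).1 rfl) (fun h => (hK _ h).2 rfl)
  obtain ⟨θ'⟩ := φ'.nonempty_comp_equiv (F := F') (F' := K) (fun e => by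
    obtain ⟨k, rfl⟩ := φ'.edgeEquiv.symm.surjective e
    obtain ⟨f, rfl⟩ := (Equiv.setCongr edgeSet_twoSum_comm).surjective k
    obtain ⟨e, rfl⟩ := φ.edgeEquiv.surjective f
    rw [Equiv.apply_symm_apply]
    exact (hF e).symm.trans (hφ e))
  exact ⟨θ.trans (κ.trans θ'.symm)⟩

end Twist

/-! ### Ranks in a complex with cohomology in one degree -/

section Rank

/-- Ranks of cocycles and coboundaries of a complex with cohomology in a single degree are
determined by the dimensions of the cochain groups. -/
theorem ranks_eq_of_exact {z r z' r' c : ℤ → ℕ} {m N : ℤ} (h : ∀ i, z i + r i = c i)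
    (h' : ∀ i, z' i + r' i = c i) (he : ∀ i, i ≠ m → z i = r (i - 1))
    (he' : ∀ i, i ≠ m → z' i = r' (i - 1)) (h0 : ∀ i < 0, c i = 0) (hN : ∀ i > N, c i = 0) (i : ℤ) :
    z i - r (i - 1) = z' i - r' (i - 1) := by
  by_cases him : i = m
  swap
  · rw [he i him, he' i him, Nat.sub_self, Nat.sub_self]
  subst him
  -- Below the exceptional degree, `r k = c k - r (k - 1)` determines the ranks starting from the
  -- zero groups on the left.
  have below (n : ℕ) : ∀ k < i, k < n → r k = r' k := by
    induction n with
    | zero => intro k _ hk; have := h k; have := h' k; have := h0 k (by simpa using hk); omega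
    | succ n ih =>
      intro k hk hkn
      have := h k; have := h' k; have := he k hk.ne; have := he' k hk.ne
      have := ih (k - 1) (by omega) (by push_cast at hkn; omega)
      omega
  -- From the exceptional degree on, `z k = c k - z (k + 1)` determines the cocycles starting from
  -- the zero groups on the right.
  have above (n : ℕ) : ∀ k ≥ i, k > N - n → z k = z' k := by
    induction n with
    | zero => intro k _ hk; have := h k; have := h' k; have := hN k (by simpa using hk); omega
    | succ n ih =>
      intro k hk hkn
      have := h k; have := h' k
      have h1 := he (k + 1) (by omega); have h2 := he' (k + 1) (by omega)
      have := ih (k + 1) (by omega) (by push_cast at hkn; omega)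
      rw [add_sub_cancel_right] at h1 h2
      omega
  rw [above (N - i + 1).toNat i le_rfl (by omega), below i.toNat (i - 1) (by omega) (by omega)]

theorem finrank_inf_ker_add_finrank_map {V W : Type*} [AddCommGroup V] [Module ℝ V]
    [FiniteDimensional ℝ V] [AddCommGroup W] [Module ℝ W] (f : V →ₗ[ℝ] W) (C : Submodule ℝ V) :
    Module.finrank ℝ ↥(C ⊓ LinearMap.ker f) + Module.finrank ℝ (C.map f) =
      Module.finrank ℝ C := by
  have h := LinearMap.finrank_range_add_finrank_ker (f.domRestrict C)
  rw [LinearMap.range_domRestrict, LinearMap.ker_domRestrict] at h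
  rw [← h, add_comm, ← Submodule.map_comap_subtype,
    Submodule.finrank_map_subtype_eq]

theorem finrank_quotient_submoduleOf {V : Type*} [AddCommGroup V] [Module ℝ V]
    [FiniteDimensional ℝ V] {B Z : Submodule ℝ V} (h : B ≤ Z) :
    Module.finrank ℝ (↥Z ⧸ B.submoduleOf Z) = Module.finrank ℝ Z - Module.finrank ℝ B := by
  have h1 := Submodule.finrank_quotient_add_finrank (B.submoduleOf Z)
  have h2 : Module.finrank ℝ (B.submoduleOf Z) = Module.finrank ℝ B :=
    (Submodule.submoduleOfEquivOfLe h).finrank_eq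
  omega

end Rank

/-! ### From numbers of states to cohomology -/

section Invariance

variable {α β α' β' : Type*} {G : Graph α β} {G' : Graph α' β'} {b : V(G)} {b' : V(G')}

/-- A state is an edge set with a set of components that contains the component of the base
vertex. -/
def enhancedStateEquiv (G : Graph α β) (b : V(G)) :
    EnhancedState G b ≃ Σ F : {F : Set β // F ⊆ E(G)}, {X : Set (Comp G F.1) // compOf G F b ∈ X} where
  toFun S := ⟨⟨S.edges, S.edges_subset⟩, ⟨S.colorX, S.base_mem⟩⟩
  invFun T := ⟨T.1.1, T.1.2, T.2.1, T.2.2⟩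
  left_inv _ := rfl
  right_inv _ := rfl

theorem finite_enhancedState [Finite V(G)] (hE : E(G).Finite) : Finite (EnhancedState G b) := by
  have : Finite {F : Set β // F ⊆ E(G)} := hE.finite_subsets
  have (F : Set β) : Finite (Comp G F) := finite_comp F
  exact Finite.of_equiv _ (enhancedStateEquiv G b).symm

open Classical in
/-- A correspondence of edge sets that preserves the numbers of edges and of components induces a
correspondence of enhanced states of the same bidegrees. -/
theorem exists_enhancedState_equiv (τ : {F : Set β // F ⊆ E(G)} ≃ {F : Set β' // F ⊆ E(G')})
    (hτ : ∀ F, (τ F).1.ncard = F.1.ncard) (hc : ∀ F, Nonempty (Comp G F.1 ≃ Comp G' (τ F).1)) :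
    ∃ Ψ : EnhancedState G b ≃ EnhancedState G' b', ∀ S, (Ψ S).dim = S.dim ∧ (Ψ S).deg = S.deg := by
  have hθ (F : {F : Set β // F ⊆ E(G)}) : ∃ θ : Comp G F.1 ≃ Comp G' (τ F).1,
      θ (compOf G F b) = compOf G' (τ F) b' := by
    obtain ⟨θ⟩ := hc F
    -- A transposition moves the image of the base component to the base component, whatever the two
    -- base vertices are.
    exact ⟨θ.trans (Equiv.swap (θ (compOf G F b)) (compOf G' (τ F) b')), by simp⟩
  choose θ hθ using hθ
  refine ⟨(enhancedStateEquiv G b).trans ((Equiv.sigmaCongr τ fun F =>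
    Equiv.subtypeEquiv (Equiv.Set.congr (θ F)) fun X => ?_).trans (enhancedStateEquiv G' b').symm),
    fun S => ⟨?_, ?_⟩⟩
  · rw [← hθ F]
    simp
  · exact congrArg Nat.cast (hτ ⟨S.edges, S.edges_subset⟩)
  · exact congrArg (fun n : ℕ => (n : ℤ) - 1) (Set.ncard_image_of_injective S.colorX
      (θ ⟨S.edges, S.edges_subset⟩).injective)

theorem finrank_cochain_eq (Ψ : EnhancedState G b ≃ EnhancedState G' b')
    (hΨ : ∀ S, (Ψ S).dim = S.dim ∧ (Ψ S).deg = S.deg) (i j : ℤ) :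
    Module.finrank ℝ (cochain G b i j) = Module.finrank ℝ (cochain G' b' i j) := by
  let L := (stateBasis G b).equiv (stateBasis G' b') Ψ
  have : (cochain G b i j).map L.toLinearMap = cochain G' b' i j := by
    rw [cochain, cochain, Submodule.map_span]
    congr 1
    ext x
    constructor
    · rintro ⟨_, ⟨S, hS, rfl⟩, rfl⟩
      exact ⟨Ψ S, by simpa [hΨ] using hS, by simp [L]⟩
    · rintro ⟨S, hS, rfl⟩
      obtain ⟨S, rfl⟩ := Ψ.surjective S
      exact ⟨_, ⟨S, by simpa [hΨ] using hS, rfl⟩, by simp [L]⟩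
  rw [← this]
  exact (LinearEquiv.finrank_map_eq L _).symm

theorem coboundaries_le_cocycles [LinearOrder β] (hE : E(G).Finite) (i j : ℤ) :
    coboundaries G b i j ≤ cocycles G b i j := by
  refine le_inf ?_ ?_
  · have := map_d_le G b hE (i - 1) j
    rwa [sub_add_cancel] at this
  · rintro _ ⟨z, -, rfl⟩
    exact LinearMap.congr_fun (d_comp_d G b hE) z

theorem cochain_eq_bot_of_neg {i : ℤ} (hi : i < 0) (j : ℤ) : cochain G b i j = ⊥ := by
  have : {S : EnhancedState G b | S.dim = i ∧ S.deg = j} = ∅ := by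
    rw [Set.eq_empty_iff_forall_notMem]
    rintro S ⟨hS, -⟩
    simp only [EnhancedState.dim] at hS
    omega
  rw [cochain, this, Set.image_empty, Submodule.span_empty]

theorem cochain_eq_bot_of_card_lt (hE : E(G).Finite) {i : ℤ} (hi : (E(G).ncard : ℤ) < i) (j : ℤ) :
    cochain G b i j = ⊥ := by
  have : {S : EnhancedState G b | S.dim = i ∧ S.deg = j} = ∅ := by
    rw [Set.eq_empty_iff_forall_notMem]
    rintro S ⟨hS, -⟩
    have := Set.ncard_le_ncard S.edges_subset hE
    simp only [EnhancedState.dim] at hS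
    omega
  rw [cochain, this, Set.image_empty, Submodule.span_empty]

/-- For connected graphs, the reduced chromatic cohomology is determined by the numbers of states
of each bidegree. -/
theorem nonempty_cohomology_equiv [LinearOrder β] [LinearOrder β'] [Finite V(G)] [Finite V(G')]
    (hE : E(G).Finite) (hE' : E(G').Finite) (hG : ∀ x y, compOf G E(G) x = compOf G E(G) y)
    (hG' : ∀ x y, compOf G' E(G') x = compOf G' E(G') y) (hV : Nat.card V(G) = Nat.card V(G'))
    (Ψ : EnhancedState G b ≃ EnhancedState G' b')
    (hΨ : ∀ S, (Ψ S).dim = S.dim ∧ (Ψ S).deg = S.deg) (i j : ℤ) :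
    Nonempty (Cohomology G b i j ≃ₗ[ℝ] Cohomology G' b' i j) := by
  have := finite_enhancedState (b := b) hE
  have := finite_enhancedState (b := b') hE'
  have : FiniteDimensional ℝ (CochainSpace G b) := (stateBasis G b).finiteDimensional_of_finite
  have : FiniteDimensional ℝ (CochainSpace G' b') := (stateBasis G' b').finiteDimensional_of_finite
  apply FiniteDimensional.nonempty_linearEquiv_of_finrank_eq
  rw [finrank_quotient_submoduleOf (coboundaries_le_cocycles hE i j),
    finrank_quotient_submoduleOf (coboundaries_le_cocycles hE' i j)]
  refine ranks_eq_of_exact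
    (z := fun k => Module.finrank ℝ (cocycles G b k j))
    (z' := fun k => Module.finrank ℝ (cocycles G' b' k j))
    (r := fun k => Module.finrank ℝ ((cochain G b k j).map (d G b)))
    (r' := fun k => Module.finrank ℝ ((cochain G' b' k j).map (d G' b')))
    (c := fun k => Module.finrank ℝ (cochain G b k j))
    (m := Nat.card V(G) - j - 1) (N := E(G).ncard)
    (fun k => finrank_inf_ker_add_finrank_map _ _)
    (fun k => (finrank_inf_ker_add_finrank_map _ _).trans (finrank_cochain_eq Ψ hΨ k j).symm)
    (fun k hk => ?_) (fun k hk => ?_) (fun k hk => ?_) (fun k hk => ?_) i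
  · rw [le_antisymm (cocycles_le_coboundaries hE hG (by omega)) (coboundaries_le_cocycles hE k j)]
    rfl
  · rw [le_antisymm (cocycles_le_coboundaries hE' hG' (by omega))
      (coboundaries_le_cocycles hE' k j)]
    rfl
  · simp [cochain_eq_bot_of_neg hk]
  · simp [cochain_eq_bot_of_card_lt hE hk]

theorem compOf_edgeSet_eq (hG : G.toSimpleGraph.Connected) (x y : V(G)) :
    compOf G E(G) x = compOf G E(G) y := by
  apply SimpleGraph.ConnectedComponent.sound
  have h : ∀ u v : V(G), G.toSimpleGraph.Adj u v → (G.restrict E(G)).toSimpleGraph.Adj u v := by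
    rintro u v ⟨hne, e, he⟩
    exact ⟨hne, e, by rw [Graph.restrict_isLink]; exact ⟨he.edge_mem, he⟩⟩
  exact (hG.preconnected x y).map (⟨fun v => v, fun {u v} => h u v⟩ :
    G.toSimpleGraph →g (G.restrict E(G)).toSimpleGraph)

/-- An equivalence of the edge sets induces an equivalence of their subsets. -/
theorem exists_subsets_equiv (σ : E(G) ≃ E(G')) :
    ∃ τ : {F : Set β // F ⊆ E(G)} ≃ {F : Set β' // F ⊆ E(G')},
      ∀ F, (τ F).1.ncard = F.1.ncard ∧ ∀ e : E(G), e.1 ∈ F.1 ↔ (σ e).1 ∈ (τ F).1 := by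
  refine ⟨(Equiv.Set.powerset E(G)).trans ((Equiv.Set.congr σ).trans
    (Equiv.Set.powerset E(G')).symm), fun F => ?_⟩
  change (Subtype.val '' (σ '' (Subtype.val ⁻¹' F.1))).ncard = _ ∧
    ∀ e : E(G), _ ↔ _ ∈ Subtype.val '' (σ '' (Subtype.val ⁻¹' F.1))
  constructor
  · rw [Set.ncard_image_of_injective _ Subtype.val_injective,
      Set.ncard_image_of_injective _ σ.injective,
      ← Set.ncard_image_of_injective _ Subtype.val_injective, Subtype.image_preimage_coe,
      Set.inter_eq_right.2 F.2]
  · intro e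
    simp

end Invariance

end ReducedChromatic

theorem mainTheorem6 {α β α' β' : Type*} [LinearOrder β] [LinearOrder β']
    (Γ : Graph α β) (Γ' : Graph α' β') (hV : V(Γ).Finite) (hE : E(Γ).Finite)
    (hconn : Γ.toSimpleGraph.Connected) (htwist : ReducedChromatic.IsWhitneyTwist.{w} Γ Γ')
    (b : V(Γ)) (b' : V(Γ')) (i j : ℤ) :
    Nonempty (ReducedChromatic.Cohomology Γ b i j ≃ₗ[ℝ] ReducedChromatic.Cohomology Γ' b' i j) := by
  open ReducedChromatic in
  obtain ⟨σ, hσ⟩ := htwist.exists_edges_equiv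
  obtain ⟨τ, hτ⟩ := exists_subsets_equiv σ
  obtain ⟨Ψ, hΨ⟩ := exists_enhancedState_equiv (b := b) (b' := b') τ (fun F => (hτ F).1)
    (fun F => hσ _ _ (hτ F).2)
  have : Finite V(Γ) := hV
  have hE' : E(Γ').Finite := by
    have : Finite E(Γ) := hE
    exact Set.finite_coe_iff.1 (Finite.of_equiv _ σ)
  -- The components of the empty state are the vertices, so the numbers of vertices agree.
  obtain ⟨θ⟩ := hσ ∅ ∅ (by simp)
  have eV : V(Γ) ≃ V(Γ') :=
    (Equiv.ofBijective _ ⟨compOf_empty_injective, compOf_surjective ∅⟩).trans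
      (θ.trans (Equiv.ofBijective _ ⟨compOf_empty_injective, compOf_surjective ∅⟩).symm)
  have : Finite V(Γ') := Finite.of_equiv _ eV
  -- Comparing the states with all edges transfers connectedness to `Γ'`.
  obtain ⟨κ⟩ := hσ E(Γ) E(Γ') (by simp)
  have hG := compOf_edgeSet_eq hconn
  refine nonempty_cohomology_equiv hE hE' hG (fun x y => κ.symm.injective ?_)
    (Nat.card_congr eV) Ψ hΨ i j
  obtain ⟨p, hp⟩ := compOf_surjective _ (κ.symm (compOf Γ' E(Γ') x))
  obtain ⟨q, hq⟩ := compOf_surjective _ (κ.symm (compOf Γ' E(Γ') y))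
  rw [← hp, ← hq]
  exact hG p q
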